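/- Let $A\in\mathbb{Q}^{n\times n}$ be expanding (all its complex eigenvalues have modulus $>1$) and put $B=A^{-1}$; let ${}^*$ denote the transpose. For an additive subgroup $L\subset\mathbb{Q}^n$ and an invertible rational matrix $M$ write $L[M]=\bigcup_{k\ge1}(L+ML+\dots+M^{k-1}L)$ and $\mathbb{Z}^n(M)=\bigcup_{k\ge 1}(M^{-k}\mathbb{Z}^n+\dots+M^{k}\mathbb{Z}^n)$. For $M\in\{B,B^*\}$ let $b=|\mathbb{Z}^n[M]/M\mathbb{Z}^n[M]|$ and let $\nu_M(y)$ be the integer $k$ with $y\in M^k\mathbb{Z}^n[M]\setminus M^{k+1}\mathbb{Z}^n[M]$, or $\infty$ if $y$ lies in all $M^k\mathbb{Z}^n[M]$. Let $\mathbb{Z}^n((M))$ be the (Hausdorff) completion of $\mathbb{Z}^n(M)$ with respect to the distance $b^{-\nu_M(y-y')}$ (where $b^{-\infty}=0$), and let $\mathbb{K}_A=\mathbb{R}^n\times\mathbb{Z}^n((B))$. Let $\Lambda,\Gamma$ be full rank lattices with $\mathbb{Z}^n[A]\cap\mathbb{Z}^n[B]\subset\Lambda$ and $\Gamma[A^*]\cap\Gamma[B^*]\subset\Lambda^*:=\{x\in\mathbb{Z}^n\mid\langle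 x,z\rangle\in\mathbb{Z}\text{ for all }z\in\Lambda\}$. Let $\mathcal{E}\subset\mathbb{Z}^n$ be a complete set of representatives of $\mathbb{Z}^n[B]/B\mathbb{Z}^n[B]$ and $\mathcal{E}^*\subset\Gamma$ one of $\Gamma[B^*]/B^*\Gamma[B^*]$, both containing $0$. Then every $y\in\mathbb{Z}^n((B))$ has a unique expansion $y=\sum_{j}B^jy_j$ with $y_j\in\mathcal{E}$, and every $s\in\mathbb{Z}^n((B^*))$ has a unique expansion $s=\sum_{j}(B^*)^js_j$ with $s_j\in\mathcal{E}^*$, where the digits vanish for all sufficiently small $j\in\mathbb{Z}$. Put $\{y\}_B=\sum_{j<0}B^jy_j\in\mathbb{Q}^n$ and $$S_s(y)=\sum_{j\in\mathbb{Z}}\langle\{B^jy\}_B,s_j\rangle ,$$ a sum with only finitely many nonzero terms. For $r\in\mathbb{R}^n$ and $s\in\mathbb{Z}^n((B^*))$ let $$\chi_r(x)=\exp(2\pi i\langle x,r\rangle),\qquad \chi_s(y)=\exp(2\pi i S_s(y)),\qquad \chi_{r,s}(x,y)=\chi_r(x)\chi_s(y).$$ Then the characters of $\mathbb{K}_A$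 (continuous homomorphisms to the unit circle) are exactly the maps $\chi_{r,s}$ with $r\in\mathbb{R}^n$ and $s\in\mathbb{Z}^n((B^*))$. The map $(r,s)\mapsto\chi_{r,s}$ is an isomorphism of topological groups from $\mathbb{R}^n\times\mathbb{Z}^n((B^*))$ onto the Pontryagin dual of $\mathbb{K}_A$, and $s\mapsto\chi_s$ is an isomorphism of topological groups from $\mathbb{Z}^n((B^*))$ onto the Pontryagin dual of $\mathbb{Z}^n((B))$ (duals with the compact-open topology). -/

import Mathlib

open scoped Matrix

noncomputable section

namespace RationalTile

variable {n : ℕ}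

/-- The coordinatewise inclusion `ℤⁿ → ℚⁿ`. -/
def intVec (n : ℕ) : (Fin n → ℤ) →ₗ[ℤ] (Fin n → ℚ) where
  toFun z := fun i => (z i : ℚ)
  map_add' _ _ := by ext; simp
  map_smul' _ _ := by ext; simp

/-- `ℤⁿ` as a `ℤ`-submodule of `ℚⁿ`. -/
def stdLattice (n : ℕ) : Submodule ℤ (Fin n → ℚ) := LinearMap.range (intVec n)

/-- Multiplication of column vectors of `ℚⁿ` by an invertible rational matrix. -/
def act (M : GL (Fin n) ℚ) : (Fin n → ℚ) →ₗ[ℤ] (Fin n → ℚ) :=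
  (Matrix.mulVecLin (M : Matrix (Fin n) (Fin n) ℚ)).restrictScalars ℤ

/-- The transpose of an invertible rational matrix. -/
def transposeGL (M : GL (Fin n) ℚ) : GL (Fin n) ℚ where
  val := (M : Matrix (Fin n) (Fin n) ℚ)ᵀ
  inv := ((M⁻¹ : GL (Fin n) ℚ) : Matrix (Fin n) (Fin n) ℚ)ᵀ
  val_inv := by rw [← Matrix.transpose_mul, ← Units.val_mul, inv_mul_cancel]; simp
  inv_val := by rw [← Matrix.transpose_mul, ← Units.val_mul, mul_inv_cancel]; simp

/-- A rational matrix is expanding if all its complex eigenvalues lie outside the closed unit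
disc. -/
def IsExpanding (M : Matrix (Fin n) (Fin n) ℚ) : Prop :=
  ∀ z : ℂ, Module.End.HasEigenvalue (Matrix.toLin' (M.map (algebraMap ℚ ℂ))) z → 1 < ‖z‖

/-- `L[M] = ⋃ₖ (L + M L + ⋯ + Mᵏ⁻¹ L)`. -/
def poly (L : Submodule ℤ (Fin n → ℚ)) (M : GL (Fin n) ℚ) : Submodule ℤ (Fin n → ℚ) :=
  ⨆ j : ℕ, L.map (act (M ^ j))

/-- `ℤⁿ(M) = ⋃ₖ (M⁻ᵏ ℤⁿ + ⋯ + Mᵏ ℤⁿ)`. -/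
def laurent (M : GL (Fin n) ℚ) : Submodule ℤ (Fin n → ℚ) :=
  ⨆ j : ℤ, (stdLattice n).map (act (M ^ j))

/-- `Mᵏ ℤⁿ[M]` for `k ∈ ℤ`. -/
def fil (M : GL (Fin n) ℚ) (k : ℤ) : Submodule ℤ (Fin n → ℚ) :=
  (poly (stdLattice n) M).map (act (M ^ k))

/-- The order `|ℤⁿ[M] / M ℤⁿ[M]|`. -/
def residueCard (M : GL (Fin n) ℚ) : ℕ :=
  ((poly (stdLattice n) M).map (act M)).toAddSubgroup.relIndex
    (poly (stdLattice n) M).toAddSubgroup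

open Classical in
/-- The `M`-adic valuation: the `k` with `y ∈ Mᵏ ℤⁿ[M] ∖ Mᵏ⁺¹ ℤⁿ[M]` (there is at most one), and
`∞` if there is none, which for `y ∈ ℤⁿ(M)` means that `y` lies in every `Mᵏ ℤⁿ[M]`. -/
def valuation (M : GL (Fin n) ℚ) (y : Fin n → ℚ) : WithTop ℤ :=
  if h : ∃ k : ℤ, y ∈ fil M k ∧ y ∉ fil M (k + 1) then ((h.choose : ℤ) : WithTop ℤ) else ⊤

/-- `b ^ (-ν)` with the convention `b ^ (-∞) = 0`. -/
def expNeg (b : ℕ) : WithTop ℤ → ℝ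
  | ⊤ => 0
  | (k : ℤ) => (b : ℝ) ^ (-k)

/-- `|y| = b ^ (-ν(y))` for `b = |ℤⁿ[M] / M ℤⁿ[M]|`, the distance of `y` to `0`. -/
def adicNorm (M : GL (Fin n) ℚ) (y : Fin n → ℚ) : ℝ := expNeg (residueCard M) (valuation M y)

/-! Elementary facts: the function `adicNorm` is an ultrametric group seminorm on `ℤⁿ(M)`. -/

theorem act_mul (M N : GL (Fin n) ℚ) (y : Fin n → ℚ) : act (M * N) y = act M (act N y) := by
  simp [act]

theorem act_one (y : Fin n → ℚ) : act (1 : GL (Fin n) ℚ) y = y := by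
  simp [act]

theorem mem_map_act {L : Submodule ℤ (Fin n → ℚ)} {M : GL (Fin n) ℚ} {y : Fin n → ℚ} :
    y ∈ L.map (act M) ↔ act M⁻¹ y ∈ L := by
  constructor
  · rintro ⟨x, hx, rfl⟩
    rw [← act_mul, inv_mul_cancel, act_one]
    exact hx
  · intro h
    exact ⟨_, h, by rw [← act_mul, mul_inv_cancel, act_one]⟩

theorem map_act_map_act (L : Submodule ℤ (Fin n → ℚ)) (M N : GL (Fin n) ℚ) :
    (L.map (act N)).map (act M) = L.map (act (M * N)) := by
  ext y
  rw [mem_map_act, mem_map_act, mem_map_act, ← act_mul, mul_inv_rev]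

theorem act_mem_fil {M : GL (Fin n) ℚ} {y : Fin n → ℚ} (j k : ℤ) :
    act (M ^ j) y ∈ fil M (k + j) ↔ y ∈ fil M k := by
  unfold fil
  rw [mem_map_act, mem_map_act, ← act_mul, ← zpow_neg, ← zpow_neg, ← zpow_add]
  congr! 3
  ring_nf

theorem map_poly_le (L : Submodule ℤ (Fin n → ℚ)) (M : GL (Fin n) ℚ) :
    (poly L M).map (act M) ≤ poly L M := by
  unfold poly
  rw [Submodule.map_iSup]
  refine iSup_le fun j => ?_
  rw [map_act_map_act, ← pow_succ']
  exact le_iSup (fun j : ℕ => L.map (act (M ^ j))) (j + 1)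

theorem poly_eq_sup (L : Submodule ℤ (Fin n → ℚ)) (M : GL (Fin n) ℚ) :
    poly L M = L ⊔ (poly L M).map (act M) := by
  apply le_antisymm
  · conv_lhs => unfold poly
    refine iSup_le fun j => ?_
    cases j with
    | zero =>
      refine le_trans ?_ le_sup_left
      rintro _ ⟨x, hx, rfl⟩
      rw [pow_zero, act_one]
      exact hx
    | succ j =>
      refine le_trans ?_ le_sup_right
      rw [pow_succ', ← map_act_map_act]
      exact Submodule.map_mono (le_iSup (fun j : ℕ => L.map (act (M ^ j))) j)
  · refine sup_le ?_ (map_poly_le L M)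
    intro x hx
    refine (le_iSup (fun j : ℕ => L.map (act (M ^ j))) 0) ⟨x, hx, ?_⟩
    rw [pow_zero, act_one]

theorem fil_succ_le (M : GL (Fin n) ℚ) (k : ℤ) : fil M (k + 1) ≤ fil M k := by
  unfold fil
  rw [zpow_add_one, ← map_act_map_act]
  exact Submodule.map_mono (map_poly_le _ M)

theorem fil_antitone (M : GL (Fin n) ℚ) : Antitone (fil M) :=
  antitone_int_of_succ_le (fil_succ_le M)

theorem exists_mem_fil {M : GL (Fin n) ℚ} {y : Fin n → ℚ} (hy : y ∈ laurent M) :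
    ∃ k, y ∈ fil M k := by
  have h : laurent M ≤ ⨆ k, fil M k := by
    refine iSup_mono fun j => Submodule.map_mono ?_
    rw [poly_eq_sup]
    exact le_sup_left
  have hd : Directed (· ≤ ·) (fil M) := by
    intro i j
    exact ⟨min i j, fil_antitone M (min_le_left _ _), fil_antitone M (min_le_right _ _)⟩
  exact (Submodule.mem_iSup_of_directed _ hd).1 (h hy)

theorem valuation_eq {M : GL (Fin n) ℚ} {y : Fin n → ℚ} {k : ℤ} (h1 : y ∈ fil M k)
    (h2 : y ∉ fil M (k + 1)) : valuation M y = k := by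
  have h : ∃ k : ℤ, y ∈ fil M k ∧ y ∉ fil M (k + 1) := ⟨k, h1, h2⟩
  unfold valuation
  rw [dif_pos h]
  obtain ⟨h3, h4⟩ := h.choose_spec
  congr 1
  apply le_antisymm
  · by_contra! hlt
    exact h2 (fil_antitone M (by omega) h3)
  · by_contra! hlt
    exact h4 (fil_antitone M (by omega) h1)

theorem valuation_eq_coe_iff {M : GL (Fin n) ℚ} {y : Fin n → ℚ} {k : ℤ} :
    valuation M y = k ↔ y ∈ fil M k ∧ y ∉ fil M (k + 1) := by
  refine ⟨fun h => ?_, fun h => valuation_eq h.1 h.2⟩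
  by_cases hex : ∃ k : ℤ, y ∈ fil M k ∧ y ∉ fil M (k + 1)
  · obtain ⟨l, hl⟩ := hex
    have := valuation_eq hl.1 hl.2
    rw [h] at this
    obtain rfl : k = l := by exact_mod_cast this
    exact hl
  · unfold valuation at h
    rw [dif_neg hex] at h
    exact absurd h (WithTop.coe_ne_top).symm

theorem exists_valuation_le {M : GL (Fin n) ℚ} {y : Fin n → ℚ} {m : ℤ} (hy : y ∈ laurent M)
    (hm : y ∉ fil M (m + 1)) : ∃ k ≤ m, valuation M y = k := by
  obtain ⟨k₀, hk₀⟩ := exists_mem_fil hy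
  have hb : ∀ k : ℤ, y ∈ fil M k → k ≤ m := by
    intro k hk
    by_contra! hlt
    exact hm (fil_antitone M (by omega) hk)
  obtain ⟨k, hk, hmax⟩ := Int.exists_greatest_of_bdd (P := fun k => y ∈ fil M k) ⟨m, hb⟩ ⟨k₀, hk₀⟩
  refine ⟨k, hb k hk, valuation_eq hk fun h => ?_⟩
  have := hmax _ h
  omega

theorem exists_nsmul_mem (M : GL (Fin n) ℚ) :
    ∃ N : ℕ, N ≠ 0 ∧ ∀ x ∈ stdLattice n, (N : ℤ) • x ∈ (stdLattice n).map (act M) := by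
  let P : Matrix (Fin n) (Fin n) ℚ := ((M⁻¹ : GL (Fin n) ℚ) : Matrix (Fin n) (Fin n) ℚ)
  let N : ℕ := ∏ i, ∏ j, (P i j).den
  have hN : ∀ i j, ∃ c : ℤ, (N : ℚ) * P i j = c := by
    intro i j
    have h1 : (P i j).den ∣ N :=
      (Finset.dvd_prod_of_mem (fun j => (P i j).den) (Finset.mem_univ j)).trans
        (Finset.dvd_prod_of_mem (fun i => ∏ j, (P i j).den) (Finset.mem_univ i))
    obtain ⟨c, hc⟩ := h1
    refine ⟨c * (P i j).num, ?_⟩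
    rw [hc]
    push_cast
    have := Rat.mul_den_eq_num (P i j)
    linear_combination (c : ℚ) * this
  choose c hc using hN
  refine ⟨N, ?_, ?_⟩
  · exact Finset.prod_ne_zero_iff.2 fun i _ => Finset.prod_ne_zero_iff.2 fun j _ => (P i j).den_nz
  · rintro _ ⟨z, rfl⟩
    rw [mem_map_act]
    refine ⟨fun i => ∑ j, c i j * z j, ?_⟩
    ext i
    simp only [intVec, act, LinearMap.coe_mk, AddHom.coe_mk, map_smul, Pi.smul_apply,
      LinearMap.coe_restrictScalars, Matrix.mulVecLin_apply, Matrix.mulVec, dotProduct]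
    push_cast
    rw [zsmul_eq_mul, Finset.mul_sum]
    refine Finset.sum_congr rfl fun j _ => ?_
    rw [← hc]
    simp only [P, Matrix.coe_units_inv]
    push_cast
    ring

theorem residueCard_ne_zero (M : GL (Fin n) ℚ) : residueCard M ≠ 0 := by
  unfold residueCard
  set H := (poly (stdLattice n) M).map (act M) with hH
  have h1 : (poly (stdLattice n) M).toAddSubgroup
      = (stdLattice n).toAddSubgroup ⊔ H.toAddSubgroup := by
    conv_lhs => rw [poly_eq_sup]
    exact Submodule.sup_toAddSubgroup _ _
  rw [h1, AddSubgroup.relIndex_sup_right]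
  obtain ⟨N, hN0, hN⟩ := exists_nsmul_mem M
  have : Module.Finite ℤ (stdLattice n) := by
    unfold stdLattice
    infer_instance
  have hfin : Finite (stdLattice n ⧸ H.submoduleOf (stdLattice n)) := by
    refine Module.finite_of_fg_torsion _ fun q => ?_
    obtain ⟨x, rfl⟩ := Submodule.Quotient.mk_surjective _ q
    refine ⟨⟨(N : ℤ), mem_nonZeroDivisors_of_ne_zero (by exact_mod_cast hN0)⟩, ?_⟩
    rw [Submonoid.mk_smul, ← Submodule.Quotient.mk_smul, Submodule.Quotient.mk_eq_zero]
    refine Submodule.map_mono ?_ (hN x x.2)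
    conv_rhs => rw [poly_eq_sup]
    exact le_sup_left
  exact (Nat.card_pos (α := stdLattice n ⧸ H.submoduleOf (stdLattice n))).ne'

theorem one_le_residueCard (M : GL (Fin n) ℚ) : (1 : ℝ) ≤ residueCard M := by
  exact_mod_cast Nat.one_le_iff_ne_zero.2 (residueCard_ne_zero M)

theorem expNeg_nonneg (b : ℕ) (v : WithTop ℤ) : 0 ≤ expNeg b v := by
  cases v with
  | top => exact le_rfl
  | coe k => exact zpow_nonneg (Nat.cast_nonneg b) _

theorem adicNorm_zero (M : GL (Fin n) ℚ) : adicNorm M 0 = 0 := by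
  have h : valuation M (0 : Fin n → ℚ) = ⊤ := by
    unfold valuation
    rw [dif_neg]
    rintro ⟨k, -, h⟩
    exact h (Submodule.zero_mem _)
  unfold adicNorm
  rw [h]
  rfl

theorem adicNorm_neg (M : GL (Fin n) ℚ) (y : Fin n → ℚ) : adicNorm M (-y) = adicNorm M y := by
  have h : valuation M (-y) = valuation M y := by
    by_cases hex : ∃ k : ℤ, y ∈ fil M k ∧ y ∉ fil M (k + 1)
    · obtain ⟨k, h1, h2⟩ := hex
      rw [valuation_eq h1 h2]
      exact valuation_eq (neg_mem h1) fun h => h2 (neg_mem_iff.1 h)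
    · have hex' : ¬ ∃ k : ℤ, -y ∈ fil M k ∧ -y ∉ fil M (k + 1) := by
        simpa only [neg_mem_iff] using hex
      unfold valuation
      rw [dif_neg hex, dif_neg hex']
  unfold adicNorm
  rw [h]

theorem adicNorm_add_le_max {M : GL (Fin n) ℚ} {x y : Fin n → ℚ} (hx : x ∈ laurent M)
    (hy : y ∈ laurent M) : adicNorm M (x + y) ≤ max (adicNorm M x) (adicNorm M y) := by
  have key : ∀ {z : Fin n → ℚ} {m : ℤ}, z ∈ laurent M → z ∉ fil M (m + 1) →
      expNeg (residueCard M) m ≤ adicNorm M z := by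
    intro z m hz hm
    obtain ⟨k, hk, hv⟩ := exists_valuation_le hz hm
    unfold adicNorm
    rw [hv]
    exact zpow_le_zpow_right₀ (one_le_residueCard M) (by omega)
  rcases h : valuation M (x + y) with _ | m
  · have h0 : adicNorm M (x + y) = 0 := by
      unfold adicNorm
      rw [h]
      rfl
    rw [h0]
    exact le_max_of_le_left (expNeg_nonneg _ _)
  · have h' := (valuation_eq_coe_iff (k := m)).1 h
    have hm : adicNorm M (x + y) = expNeg (residueCard M) m := by
      unfold adicNorm
      rw [h]
      rfl
    rw [hm]
    by_cases hxm : x ∈ fil M (m + 1)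
    · by_cases hym : y ∈ fil M (m + 1)
      · exact absurd (Submodule.add_mem _ hxm hym) h'.2
      · exact le_max_of_le_right (key hy hym)
    · exact le_max_of_le_left (key hx hxm)

theorem valuation_act (M : GL (Fin n) ℚ) (j : ℤ) (y : Fin n → ℚ) :
    valuation M (act (M ^ j) y) = valuation M y + j := by
  by_cases hex : ∃ k : ℤ, y ∈ fil M k ∧ y ∉ fil M (k + 1)
  · obtain ⟨k, h1, h2⟩ := hex
    rw [valuation_eq h1 h2, ← WithTop.coe_add]
    refine valuation_eq ((act_mem_fil j k).2 h1) fun h => h2 ?_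
    rw [show k + j + 1 = (k + 1) + j by ring] at h
    exact (act_mem_fil j (k + 1)).1 h
  · have hex' : ¬ ∃ k : ℤ, act (M ^ j) y ∈ fil M k ∧ act (M ^ j) y ∉ fil M (k + 1) := by
      rintro ⟨k, h1, h2⟩
      refine hex ⟨k - j, (act_mem_fil j (k - j)).1 ?_, fun h => h2 ?_⟩
      · rwa [sub_add_cancel]
      · have := (act_mem_fil j (k - j + 1)).2 h
        rwa [show k - j + 1 + j = k + 1 by ring] at this
    unfold valuation
    rw [dif_neg hex, dif_neg hex', WithTop.top_add]

theorem adicNorm_act (M : GL (Fin n) ℚ) (j : ℤ) (y : Fin n → ℚ) :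
    adicNorm M (act (M ^ j) y) = (residueCard M : ℝ) ^ (-j) * adicNorm M y := by
  have hb : (residueCard M : ℝ) ≠ 0 := Nat.cast_ne_zero.2 (residueCard_ne_zero M)
  unfold adicNorm
  rw [valuation_act]
  rcases valuation M y with _ | k
  · exact (mul_zero _).symm
  · change (residueCard M : ℝ) ^ (-(k + j)) = (residueCard M : ℝ) ^ (-j) * (residueCard M : ℝ) ^ (-k)
    rw [← zpow_add₀ hb]
    ring_nf

theorem act_mem_laurent {M : GL (Fin n) ℚ} (j : ℤ) {y : Fin n → ℚ} (hy : y ∈ laurent M) :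
    act (M ^ j) y ∈ laurent M := by
  have h : (laurent M).map (act (M ^ j)) ≤ laurent M := by
    unfold laurent
    rw [Submodule.map_iSup]
    refine iSup_le fun i => ?_
    rw [map_act_map_act, ← zpow_add]
    exact le_iSup (fun j : ℤ => (stdLattice n).map (act (M ^ j))) (j + i)
  exact h ⟨y, hy, rfl⟩

theorem act_intVec_mem_laurent (M : GL (Fin n) ℚ) (j : ℤ) (z : Fin n → ℤ) :
    act (M ^ j) (intVec n z) ∈ laurent M :=
  (le_iSup (fun j : ℤ => (stdLattice n).map (act (M ^ j))) j) ⟨_, ⟨z, rfl⟩, rfl⟩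

/-! The completion `ℤⁿ((M))`. -/

/-- `ℤⁿ(M)` as a type of its own, to carry the `M`-adic metric (and not the one of `ℚⁿ`). -/
def LaurentGroup (M : GL (Fin n) ℚ) : Type := ↥(laurent M)

instance (M : GL (Fin n) ℚ) : AddCommGroup (LaurentGroup M) :=
  inferInstanceAs (AddCommGroup ↥(laurent M))

/-- The `M`-adic distance `d(y, y') = b ^ (-ν(y - y'))` on `ℤⁿ(M)`. -/
instance (M : GL (Fin n) ℚ) : SeminormedAddCommGroup (LaurentGroup M) :=
  AddGroupSeminorm.toSeminormedAddCommGroup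
    { toFun := fun y : LaurentGroup M => adicNorm M y.1
      map_zero' := adicNorm_zero M
      add_le' := fun x y => (adicNorm_add_le_max x.2 y.2).trans
        (max_le_add_of_nonneg (expNeg_nonneg _ _) (expNeg_nonneg _ _))
      neg' := fun y => adicNorm_neg M y.1 }

/-- The space `ℤⁿ((M))`: the (Hausdorff) completion of `ℤⁿ(M)` for the `M`-adic distance. -/
abbrev Series (M : GL (Fin n) ℚ) : Type := UniformSpace.Completion (LaurentGroup M)

/-- Multiplication by `Mʲ` on `ℤⁿ(M)`. -/
def laurentMul (M : GL (Fin n) ℚ) (j : ℤ) : LaurentGroup M →+ LaurentGroup M where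
  toFun y := ⟨act (M ^ j) y.1, act_mem_laurent j y.2⟩
  map_zero' := Subtype.ext (map_zero (act (M ^ j)))
  map_add' x y := Subtype.ext (map_add (act (M ^ j)) x.1 y.1)

theorem continuous_laurentMul (M : GL (Fin n) ℚ) (j : ℤ) : Continuous (laurentMul M j) :=
  AddMonoidHomClass.continuous_of_bound (laurentMul M j) ((residueCard M : ℝ) ^ (-j))
    fun y => (adicNorm_act M j y.1).le

/-- Multiplication by `Mʲ` on `ℤⁿ((M))`, the continuous extension of that on `ℤⁿ(M)`. -/
def seriesMul (M : GL (Fin n) ℚ) (j : ℤ) : Series M →+ Series M :=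
  (laurentMul M j).completion (continuous_laurentMul M j)

/-- The monomial `Mʲ z` with `z ∈ ℤⁿ`, as an element of `ℤⁿ((M))`. -/
def monomial (M : GL (Fin n) ℚ) (j : ℤ) (z : Fin n → ℤ) : Series M :=
  UniformSpace.Completion.coe' (α := LaurentGroup M)
    ⟨act (M ^ j) (intVec n z), act_intVec_mem_laurent M j z⟩

/-! Digit expansions and fractional parts. -/

/-- `E ⊆ L ∩ ℤⁿ` is a complete set of representatives of `L[M] / M L[M]` that contains `0`. -/
def IsResidueSystem (L : Submodule ℤ (Fin n → ℚ)) (M : GL (Fin n) ℚ) (E : Set (Fin n → ℤ)) :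
    Prop :=
  (∀ e ∈ E, intVec n e ∈ L) ∧ 0 ∈ E ∧
    ∀ x ∈ poly L M, ∃! e, e ∈ E ∧ x - intVec n e ∈ (poly L M).map (act M)

/-- `y = ∑ⱼ Mʲ dⱼ` in `ℤⁿ((M))`, with digits `dⱼ ∈ E` that vanish for all small `j`. -/
def IsExpansion (M : GL (Fin n) ℚ) (E : Set (Fin n → ℤ)) (y : Series M) (d : ℤ → Fin n → ℤ) :
    Prop :=
  (∀ j, d j ∈ E) ∧ (∃ N : ℤ, ∀ j < N, d j = 0) ∧ HasSum (fun j : ℤ => monomial M j (d j)) y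

open Classical in
/-- The digits of the `M`-adic expansion of `y` with digits in `E`. -/
def digits (M : GL (Fin n) ℚ) (E : Set (Fin n → ℤ)) (y : Series M) : ℤ → Fin n → ℤ :=
  if h : ∃ d, IsExpansion M E y d then h.choose else 0

/-- The fractional part `{y} = ∑_{j < 0} Mʲ dⱼ ∈ ℚⁿ`, where the `dⱼ` are the digits of `y`. -/
def fracPart (M : GL (Fin n) ℚ) (E : Set (Fin n → ℤ)) (y : Series M) : Fin n → ℚ :=
  ∑ᶠ (j : ℤ) (_ : j < 0), act (M ^ j) (intVec n (digits M E y j))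

/-- The dual lattice `Λ* = {x ∈ ℤⁿ | ⟨x, z⟩ ∈ ℤ for all z ∈ Λ}`. -/
def dualLattice (L : Submodule ℤ (Fin n → ℚ)) : Submodule ℤ (Fin n → ℚ) where
  carrier := {x | x ∈ stdLattice n ∧ ∀ z ∈ L, ∃ m : ℤ, x ⬝ᵥ z = m}
  zero_mem' := ⟨Submodule.zero_mem _, fun z _ => ⟨0, by simp⟩⟩
  add_mem' := by
    rintro x y ⟨hx, hx'⟩ ⟨hy, hy'⟩
    refine ⟨Submodule.add_mem _ hx hy, fun z hz => ?_⟩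
    obtain ⟨k, hk⟩ := hx' z hz
    obtain ⟨l, hl⟩ := hy' z hz
    exact ⟨k + l, by rw [add_dotProduct, hk, hl]; push_cast; rfl⟩
  smul_mem' := by
    rintro c x ⟨hx, hx'⟩
    refine ⟨Submodule.smul_mem _ c hx, fun z hz => ?_⟩
    obtain ⟨k, hk⟩ := hx' z hz
    exact ⟨c * k, by rw [smul_dotProduct, hk, zsmul_eq_mul]; push_cast; rfl⟩

/-! The representation space of `A` and its characters. With `B = A⁻¹` and `B* = Bᵀ`, the digit
sets are `E ⊆ ℤⁿ` for `B` and `F ⊆ Γ ⊆ ℤⁿ` for `B*`. -/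

/-- The representation space `ℝⁿ × ℤⁿ((A⁻¹))`. -/
abbrev RepSpace (A : GL (Fin n) ℚ) : Type := EuclideanSpace ℝ (Fin n) × Series A⁻¹

/-- `S_s(y) = ∑ⱼ ⟨{Bʲ y}, sⱼ⟩`, where `s = ∑ⱼ (B*)ʲ sⱼ` with `sⱼ ∈ F`. -/
def pairing (B : GL (Fin n) ℚ) (E F : Set (Fin n → ℤ)) (s : Series (transposeGL B))
    (y : Series B) : ℚ :=
  ∑ᶠ j : ℤ, fracPart B E (seriesMul B j y) ⬝ᵥ intVec n (digits (transposeGL B) F s j)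

/-- `χ_r(x) = exp(2πi⟨x, r⟩)` on `ℝⁿ`. -/
def realChar (r x : EuclideanSpace ℝ (Fin n)) : Circle :=
  Circle.exp (2 * Real.pi * inner ℝ x r)

/-- `χ_s(y) = exp(2πi S_s(y))` on `ℤⁿ((B))`. -/
def adicChar (B : GL (Fin n) ℚ) (E F : Set (Fin n → ℤ)) (s : Series (transposeGL B))
    (y : Series B) : Circle :=
  Circle.exp (2 * Real.pi * (pairing B E F s y : ℝ))

/-- A character of an additive topological group: a continuous map `χ` to the unit circle with
`χ(x + y) = χ(x) χ(y)`. -/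
def IsCharacter {G : Type*} [AddCommGroup G] [TopologicalSpace G] (χ : G → Circle) : Prop :=
  Continuous χ ∧ ∀ x y, χ (x + y) = χ x * χ y

end RationalTile

end

/-!
The closures of the groups `Mᵏ L[M]` are compact open subgroups of `ℤⁿ((M))`, and choosing a digit
modulo the next one of them again and again gives the expansions. Fractional parts are additive up
to `L[M⁻¹] ∩ L[M]`; on these ambiguities the pairing is integral, which makes `χ_s(y)` additive in
both arguments and gives the symmetry `χ_s(Bᵏ z) = exp(2πi⟨z, {(B*)ᵏ s}⟩)` for `z ∈ ℤⁿ`. From it one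
reads off that, up to a bounded shift, the annihilators of the closures of `Bᵏ ℤⁿ[B]` are the
closures of `(B*)⁻ᵏ ℤⁿ[B*]`, and that no nonzero `y` is annihilated by all `s`.

On a compact abelian group, a group of characters that separates points is the whole dual:
characters are orthonormal, while by Stone–Weierstrass the separating ones span a dense space of
functions. So any character of `ℤⁿ((B))` agrees with some `χ_s` on each of the compact open
subgroups; the sets of such `s` are compact and decreasing, hence have a common element. The
characters of `ℝⁿ` are found by lifting them through the covering `t ↦ exp(it)`, and a product of
two dualities is a duality.
-/

noncomputable section

namespace RationalTile

open Filter Topology UniformSpace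

variable {n : ℕ}

section SeparatingCharacters

open MeasureTheory

variable {G : Type*} [CommGroup G] [TopologicalSpace G]

/-- A character of a topological group as a complex valued continuous function. -/
def dualToContinuousMap : PontryaginDual G →* C(G, ℂ) where
  toFun φ := ⟨fun x => φ x, continuous_subtype_val.comp (map_continuous φ)⟩
  map_one' := rfl
  map_mul' _ _ := rfl

theorem dualToContinuousMap_apply (φ : PontryaginDual G) (x : G) :
    dualToContinuousMap φ x = φ x := rfl

theorem star_dualToContinuousMap (φ : PontryaginDual G) :
    star (dualToContinuousMap φ) = dualToContinuousMap φ⁻¹ :=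
  ContinuousMap.ext fun x => (Circle.coe_inv_eq_conj (φ x)).symm

theorem integral_dualToContinuousMap_eq_zero [MeasurableSpace G] [MeasurableMul G]
    (μ : Measure G) [μ.IsMulLeftInvariant] {φ : PontryaginDual G} (hφ : φ ≠ 1) :
    ∫ x, dualToContinuousMap φ x ∂μ = 0 := by
  obtain ⟨a, ha⟩ : ∃ a, φ a ≠ 1 := by
    contrapose! hφ
    exact PontryaginDual.ext hφ
  have h : (φ a : ℂ) * ∫ x, dualToContinuousMap φ x ∂μ = ∫ x, dualToContinuousMap φ x ∂μ := by
    simpa only [dualToContinuousMap_apply, map_mul, Circle.coe_mul, integral_const_mul] using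
      integral_mul_left_eq_self (μ := μ) (dualToContinuousMap φ) a
  by_contra hne
  exact ha (Circle.ext (mul_eq_right₀ hne |>.1 h))

/-- The linear span of a group of characters, as a star algebra. -/
def characterAlgebra (H : Subgroup (PontryaginDual G)) : StarSubalgebra ℂ C(G, ℂ) where
  toSubalgebra := Algebra.adjoin ℂ (dualToContinuousMap '' H)
  star_mem' := by
    change Algebra.adjoin ℂ _ ≤ star (Algebra.adjoin ℂ _)
    refine Algebra.adjoin_le ?_
    rintro _ ⟨φ, hφ, rfl⟩
    exact Algebra.subset_adjoin ⟨φ⁻¹, H.inv_mem hφ, (star_dualToContinuousMap φ).symm⟩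

theorem coe_characterAlgebra (H : Subgroup (PontryaginDual G)) :
    (characterAlgebra H : Set C(G, ℂ)) =
      (Submodule.span ℂ (dualToContinuousMap '' (H : Set (PontryaginDual G))) :
        Submodule ℂ C(G, ℂ)) := by
  have hclosed : Submonoid.closure (dualToContinuousMap '' (H : Set (PontryaginDual G))) =
      H.toSubmonoid.map dualToContinuousMap := Submonoid.closure_eq (H.toSubmonoid.map _)
  have hspan := Algebra.adjoin_eq_span ℂ (dualToContinuousMap '' (H : Set (PontryaginDual G)))
  rw [hclosed] at hspan
  exact congrArg SetLike.coe hspan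

variable [CompactSpace G]

theorem dense_span_of_separating {H : Subgroup (PontryaginDual G)}
    (hH : ∀ x, (∀ φ ∈ H, φ x = 1) → x = 1) :
    Dense (Submodule.span ℂ (dualToContinuousMap '' (H : Set (PontryaginDual G))) :
      Set C(G, ℂ)) := by
  rw [← coe_characterAlgebra, dense_iff_closure_eq, ← StarSubalgebra.topologicalClosure_coe,
    ContinuousMap.starSubalgebra_topologicalClosure_eq_top_of_separatesPoints,
    StarSubalgebra.coe_top]
  intro x y hxy
  by_contra! h
  refine hxy (div_eq_one.1 (hH _ fun φ hφ => ?_))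
  rw [map_div, div_eq_one]
  exact Circle.ext (h _ ⟨_, Algebra.subset_adjoin ⟨φ, hφ, rfl⟩, rfl⟩)

theorem continuous_integral_continuousMap {X : Type*} [TopologicalSpace X] [CompactSpace X]
    [MeasurableSpace X] [BorelSpace X] (μ : Measure X) [IsFiniteMeasure μ] :
    Continuous fun f : C(X, ℂ) => ∫ x, f x ∂μ := by
  have hL1 : Continuous fun f : C(X, ℂ) => ∫ x, ContinuousMap.toLp 1 μ ℂ f x ∂μ :=
    continuous_integral.comp (ContinuousMap.toLp 1 μ ℂ).continuous
  exact hL1.congr fun f => integral_congr_ae (ContinuousMap.coeFn_toLp μ f)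

theorem integral_mul_dual_eq_zero_of_mem_span [IsTopologicalGroup G] [MeasurableSpace G]
    [BorelSpace G] (μ : Measure G) [IsFiniteMeasure μ] [μ.IsMulLeftInvariant]
    {H : Subgroup (PontryaginDual G)} {ψ : PontryaginDual G} (hψ : ψ ∉ H) {f : C(G, ℂ)}
    (hf : f ∈ Submodule.span ℂ (dualToContinuousMap '' (H : Set (PontryaginDual G)))) :
    ∫ x, (f * dualToContinuousMap ψ⁻¹) x ∂μ = 0 := by
  have hint (f : C(G, ℂ)) : Integrable f μ :=
    f.continuous.integrable_of_hasCompactSupport (HasCompactSupport.of_compactSpace _)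
  induction hf using Submodule.span_induction with
  | mem f hf =>
    obtain ⟨φ, hφ, rfl⟩ := hf
    have hne : φ * ψ⁻¹ ≠ 1 := fun h => hψ (mul_inv_eq_one.1 h ▸ hφ)
    simpa only [← map_mul] using integral_dualToContinuousMap_eq_zero μ hne
  | zero => simp
  | add f g _ _ hf hg =>
    simp only [add_mul, ContinuousMap.add_apply] at hf hg ⊢
    rw [integral_add (hint _) (hint _), hf, hg, add_zero]
  | smul c f _ hf =>
    simp only [smul_mul_assoc, ContinuousMap.smul_apply] at hf ⊢
    rw [integral_smul, hf, smul_zero]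

-- A character `ψ` outside `H` would be orthogonal to the span of `H`, hence to itself.
theorem subgroup_dual_eq_top_of_separating [IsTopologicalGroup G] {H : Subgroup (PontryaginDual G)}
    (hH : ∀ x, (∀ φ ∈ H, φ x = 1) → x = 1) : H = ⊤ := by
  borelize G
  let μ : Measure G := Measure.haar
  refine (Subgroup.eq_top_iff' H).2 fun ψ => ?_
  by_contra hψ
  have hcont : Continuous fun f : C(G, ℂ) => ∫ x, (f * dualToContinuousMap ψ⁻¹) x ∂μ :=
    (continuous_integral_continuousMap μ).comp (continuous_mul_const _)
  have hzero : (fun f : C(G, ℂ) => ∫ x, (f * dualToContinuousMap ψ⁻¹) x ∂μ) = fun _ => 0 :=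
    hcont.ext_on (dense_span_of_separating hH) continuous_const fun f hf =>
      integral_mul_dual_eq_zero_of_mem_span μ hψ hf
  have hμ : μ.real Set.univ = 0 := by
    simpa only [← map_mul, mul_inv_cancel, map_one, ContinuousMap.one_apply, integral_const,
      Complex.real_smul, mul_one, Complex.ofReal_eq_zero] using
      congrFun hzero (dualToContinuousMap ψ)
  exact measureReal_univ_ne_zero hμ

end SeparatingCharacters

section Character

variable {G : Type*} [AddCommGroup G] [TopologicalSpace G]

/-- A character of an additive group as an element of the Pontryagin dual of its multiplicative
copy. -/
def IsCharacter.toDual {χ : G → Circle} (hχ : IsCharacter χ) :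
    PontryaginDual (Multiplicative G) :=
  ({ toFun := fun x => χ x.toAdd
     map_one' := by simpa using hχ.2 0 0
     map_mul' := fun x y => hχ.2 x.toAdd y.toAdd
     continuous_toFun := hχ.1.comp continuous_toAdd } : Multiplicative G →ₜ* Circle)

theorem isCharacter_of_dual (ψ : PontryaginDual (Multiplicative G)) :
    IsCharacter fun x : G => ψ (Multiplicative.ofAdd x) :=
  ⟨(map_continuous ψ).comp continuous_ofAdd, fun x y => by simp only [ofAdd_add, map_mul]⟩

theorem IsCharacter.map_zero {χ : G → Circle} (hχ : IsCharacter χ) : χ 0 = 1 :=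
  _root_.map_one hχ.toDual

theorem IsCharacter.map_sub {χ : G → Circle} (hχ : IsCharacter χ) (x y : G) :
    χ (x - y) = χ x / χ y :=
  map_div hχ.toDual (Multiplicative.ofAdd x) (Multiplicative.ofAdd y)

theorem IsCharacter.map_nsmul {χ : G → Circle} (hχ : IsCharacter χ) (m : ℕ) (x : G) :
    χ (m • x) = χ x ^ m :=
  map_pow hχ.toDual (Multiplicative.ofAdd x) m

theorem IsCharacter.comp {H : Type*} [AddCommGroup H] [TopologicalSpace H] {χ : G → Circle}
    (hχ : IsCharacter χ) (f : H →+ G) (hf : Continuous f) : IsCharacter fun x => χ (f x) :=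
  ⟨hχ.1.comp hf, fun x y => by simp only [map_add, hχ.2]⟩

theorem one_mem_centeredArc : (1 : Circle) ∈ Circle.centeredArc (Real.pi / 2) := by
  rw [Circle.mem_centeredArc (by linarith [Real.pi_pos])]
  simp [Real.pi_pos]

theorem IsCharacter.eq_one_of_mapsTo_centeredArc {χ : G → Circle} (hχ : IsCharacter χ)
    {V : AddSubgroup G} (h : Set.MapsTo χ V (Circle.centeredArc (Real.pi / 2))) {x : G}
    (hx : x ∈ V) : χ x = 1 := by
  refine Circle.eq_one_of_forall_pow_mem_centeredArc_pi_div_two fun m _ => ?_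
  rw [← hχ.map_nsmul]
  exact h (V.nsmul_mem hx m)

end Character

section Duality

variable {K K' : Type*} [AddCommGroup K] [TopologicalSpace K] [AddCommGroup K']
  [TopologicalSpace K']

/-- A pairing `χ : K' × K → 𝕋` through which `K'` is the Pontryagin dual of `K`. The last field says
that the inverse of `s ↦ χ s` is continuous at the trivial character for the compact-open
topology. -/
structure IsDuality (χ : K' → K → Circle) : Prop where
  map_add_left : ∀ s t x, χ (s + t) x = χ s x * χ t x
  map_add_right : ∀ s x y, χ s (x + y) = χ s x * χ s y
  continuous_uncurry : Continuous (Function.uncurry χ)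
  exists_eq : ∀ ψ, IsCharacter ψ → ∃ s, χ s = ψ
  exists_isCompact : ∀ W ∈ 𝓝 (0 : K'), ∃ C, IsCompact C ∧
    ∀ s, Set.MapsTo (χ s) C (Circle.centeredArc (Real.pi / 2)) → s ∈ W

namespace IsDuality

variable {χ : K' → K → Circle} (D : IsDuality χ)

include D

theorem isCharacter (s : K') : IsCharacter (χ s) :=
  ⟨D.continuous_uncurry.comp (Continuous.prodMk_right s), D.map_add_right s⟩

theorem isCharacter_iff {ψ : K → Circle} : IsCharacter ψ ↔ ∃ s, χ s = ψ :=
  ⟨D.exists_eq ψ, by rintro ⟨s, rfl⟩; exact D.isCharacter s⟩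

theorem isCharacter_left (x : K) : IsCharacter fun s => χ s x :=
  ⟨D.continuous_uncurry.comp (Continuous.prodMk_left x), fun s t => D.map_add_left s t x⟩

/-- The homomorphism `s ↦ χ s` to the Pontryagin dual. -/
def toDual : Multiplicative K' →* PontryaginDual (Multiplicative K) where
  toFun s := (D.isCharacter s.toAdd).toDual
  map_one' := PontryaginDual.ext fun x => (D.isCharacter_left x.toAdd).map_zero
  map_mul' s t := PontryaginDual.ext fun x => D.map_add_left s.toAdd t.toAdd x.toAdd

theorem continuous_toDual : Continuous D.toDual :=
  ContinuousMonoidHom.continuous_of_continuous_uncurry _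
    (D.continuous_uncurry.comp (continuous_toAdd.prodMap continuous_toAdd))

theorem toDual_injective [T1Space K'] : Function.Injective D.toDual := by
  refine (injective_iff_map_eq_one _).2 fun s hs => ?_
  by_contra hne
  obtain ⟨C, -, hC⟩ := D.exists_isCompact {s.toAdd}ᶜ (isOpen_compl_singleton.mem_nhds (Ne.symm hne))
  refine hC s.toAdd (fun x _ => ?_) rfl
  have hx : χ s.toAdd x = 1 := DFunLike.congr_fun hs (Multiplicative.ofAdd x)
  exact hx ▸ one_mem_centeredArc

theorem toDual_surjective : Function.Surjective D.toDual := by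
  intro ψ
  obtain ⟨s, hs⟩ := D.exists_eq _ (isCharacter_of_dual ψ)
  exact ⟨Multiplicative.ofAdd s, PontryaginDual.ext fun x => congrFun hs x.toAdd⟩

/-- The isomorphism of topological groups `s ↦ χ s` onto the Pontryagin dual. -/
def equivDual [T1Space K'] [ContinuousAdd K'] :
    Multiplicative K' ≃ₜ* PontryaginDual (Multiplicative K) where
  toMulEquiv := MulEquiv.ofBijective D.toDual ⟨D.toDual_injective, D.toDual_surjective⟩
  continuous_toFun := D.continuous_toDual
  continuous_invFun := by
    let e := MulEquiv.ofBijective D.toDual ⟨D.toDual_injective, D.toDual_surjective⟩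
    refine continuous_of_continuousAt_one e.symm ?_
    rw [ContinuousAt, _root_.map_one]
    intro W hW
    obtain ⟨C, hC, hCW⟩ := D.exists_isCompact (Multiplicative.ofAdd ⁻¹' W) hW
    have hnhds : {ψ : PontryaginDual (Multiplicative K) | Set.MapsTo ψ
        (Multiplicative.toAdd ⁻¹' C) (Circle.centeredArc (Real.pi / 2))} ∈ 𝓝 1 := by
      refine IsOpen.mem_nhds (isOpen_induced (ContinuousMap.isOpen_setOfPred_mapsTo hC
        (Circle.isOpen_centeredArc _))) fun x _ => ?_
      rw [PontryaginDual.one_apply]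
      exact one_mem_centeredArc
    refine mem_map.2 (mem_of_superset hnhds fun ψ hψ => ?_)
    obtain ⟨s, rfl⟩ := e.surjective ψ
    rw [Set.mem_preimage, e.symm_apply_apply]
    exact hCW s.toAdd fun x hx => hψ hx

theorem prod {L L' : Type*} [AddCommGroup L] [TopologicalSpace L] [AddCommGroup L']
    [TopologicalSpace L'] {χ' : L' → L → Circle} (D' : IsDuality χ') :
    IsDuality fun (s : K' × L') (x : K × L) => χ s.1 x.1 * χ' s.2 x.2 where
  map_add_left s t x := by
    simp only [Prod.fst_add, Prod.snd_add, D.map_add_left, D'.map_add_left, mul_mul_mul_comm]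
  map_add_right s x y := by
    simp only [Prod.fst_add, Prod.snd_add, D.map_add_right, D'.map_add_right, mul_mul_mul_comm]
  continuous_uncurry :=
    (D.continuous_uncurry.comp (continuous_fst.prodMap continuous_fst)).mul
      (D'.continuous_uncurry.comp (continuous_snd.prodMap continuous_snd))
  exists_eq ψ hψ := by
    obtain ⟨s, hs⟩ := D.exists_eq _ (hψ.comp (AddMonoidHom.inl K L) (Continuous.prodMk_left 0))
    obtain ⟨s', hs'⟩ := D'.exists_eq _ (hψ.comp (AddMonoidHom.inr K L) (Continuous.prodMk_right 0))
    refine ⟨(s, s'), funext fun x => ?_⟩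
    simp only [hs, hs', ← hψ.2, AddMonoidHom.inl_apply, AddMonoidHom.inr_apply, Prod.mk_add_mk,
      add_zero, zero_add]
  exists_isCompact W hW := by
    obtain ⟨V, hV, V', hV', hVW⟩ := mem_nhds_prod_iff.1 hW
    obtain ⟨C, hC, hCV⟩ := D.exists_isCompact V hV
    obtain ⟨C', hC', hCV'⟩ := D'.exists_isCompact V' hV'
    refine ⟨C ×ˢ {0} ∪ {0} ×ˢ C',
      (hC.prod isCompact_singleton).union (isCompact_singleton.prod hC'), fun s hs => hVW ⟨?_, ?_⟩⟩
    · refine hCV s.1 fun x hx => ?_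
      simpa only [(D'.isCharacter s.2).map_zero, mul_one] using hs (x := (x, 0)) (Or.inl ⟨hx, rfl⟩)
    · refine hCV' s.2 fun x hx => ?_
      simpa only [(D.isCharacter s.1).map_zero, one_mul] using hs (x := (0, x)) (Or.inr ⟨rfl, hx⟩)

end IsDuality

end Duality

section FilteredPairing

variable {K K' : Type*} [AddCommGroup K] [TopologicalSpace K] [IsTopologicalAddGroup K]
  [AddCommGroup K'] [TopologicalSpace K'] [IsTopologicalAddGroup K']

/-- A pairing of two groups filtered by compact open subgroups, such that the annihilator of the
`k`-th subgroup of either filtration is, up to a bounded shift of the index, the `-k`-th subgroup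
of the other one. -/
structure IsFilteredPairing (χ : K' → K → Circle) (U' : ℤ → AddSubgroup K')
    (U : ℤ → AddSubgroup K) : Prop where
  map_add_left : ∀ s t x, χ (s + t) x = χ s x * χ t x
  map_add_right : ∀ s x y, χ s (x + y) = χ s x * χ s y
  antitone : Antitone U
  isCompact_left : ∀ k, IsCompact (U' k : Set K')
  isCompact_right : ∀ k, IsCompact (U k : Set K)
  isOpen_left : ∀ k, IsOpen (U' k : Set K')
  isOpen_right : ∀ k, IsOpen (U k : Set K)
  exists_subset_left : ∀ W ∈ 𝓝 (0 : K'), ∃ k, (U' k : Set K') ⊆ W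
  exists_mem_left : ∀ s, ∃ k, s ∈ U' k
  exists_mem_right : ∀ x, ∃ k, x ∈ U k
  eq_one : ∃ c : ℤ, ∀ k l, c ≤ k + l → ∀ s ∈ U' l, ∀ x ∈ U k, χ s x = 1
  mem_of_eq_one : ∀ k s, (∀ x ∈ U k, χ s x = 1) → s ∈ U' (-k)
  eq_zero : ∀ x, (∀ s, χ s x = 1) → x = 0

namespace IsFilteredPairing

variable {χ : K' → K → Circle} {U' : ℤ → AddSubgroup K'} {U : ℤ → AddSubgroup K}
  (P : IsFilteredPairing χ U' U)

include P

theorem continuous_uncurry : Continuous (Function.uncurry χ) := by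
  obtain ⟨c, hc⟩ := P.eq_one
  refine continuous_iff_continuousAt.2 fun ⟨s, x⟩ => ?_
  obtain ⟨l, hs⟩ := P.exists_mem_left s
  obtain ⟨k, hx⟩ := P.exists_mem_right x
  have hleft : ∀ᶠ t in 𝓝 s, t - s ∈ U' (c - k) :=
    (continuous_sub_right s).continuousAt.eventually_mem
      ((P.isOpen_left _).mem_nhds (by simp [zero_mem]))
  have hright : ∀ᶠ y in 𝓝 x, y - x ∈ U (max k (c - l)) :=
    (continuous_sub_right x).continuousAt.eventually_mem
      ((P.isOpen_right _).mem_nhds (by simp [zero_mem]))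
  refine continuousAt_const.congr (f := fun _ => χ s x) ?_
  rw [nhds_prod_eq]
  filter_upwards [hleft.prod_mk hright] with ⟨t, y⟩ ⟨ht, hy⟩
  have hyk : y - x ∈ U k := P.antitone (le_max_left _ _) hy
  have hyl : y - x ∈ U (c - l) := P.antitone (le_max_right _ _) hy
  calc χ s x = χ (t - s + s) (y - x + x) := by
        rw [P.map_add_left, P.map_add_right, P.map_add_right,
          hc _ _ (by lia) _ ht _ hyk, hc _ _ (by lia) _ ht _ hx, hc _ _ (by lia) _ hs _ hyl,
          one_mul, one_mul, one_mul]
    _ = χ t y := by rw [sub_add_cancel, sub_add_cancel]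

theorem isCharacter (s : K') : IsCharacter (χ s) :=
  ⟨P.continuous_uncurry.comp (Continuous.prodMk_right s), P.map_add_right s⟩

theorem isCharacter_left (x : K) : IsCharacter fun s => χ s x :=
  ⟨P.continuous_uncurry.comp (Continuous.prodMk_left x), fun s t => P.map_add_left s t x⟩

theorem exists_eqOn {ψ : K → Circle} (hψ : IsCharacter ψ) (k : ℤ) :
    ∃ s, Set.EqOn (χ s) ψ (U k) := by
  have : CompactSpace (U k) := isCompact_iff_compactSpace.1 (P.isCompact_right k)
  have : CompactSpace (Multiplicative (U k)) := inferInstance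
  let restrict {φ : K → Circle} (hφ : IsCharacter φ) : PontryaginDual (Multiplicative (U k)) :=
    (hφ.comp (U k).subtype continuous_subtype_val).toDual
  let R : Multiplicative K' →* PontryaginDual (Multiplicative (U k)) :=
    { toFun := fun s => restrict (P.isCharacter s.toAdd)
      map_one' := PontryaginDual.ext fun x => (P.isCharacter_left _).map_zero
      map_mul' := fun s t => PontryaginDual.ext fun x => P.map_add_left _ _ _ }
  have htop : R.range = ⊤ := subgroup_dual_eq_top_of_separating fun x hx =>
    Multiplicative.toAdd.injective <| Subtype.ext <| P.eq_zero _ fun s =>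
      hx (R (Multiplicative.ofAdd s)) ⟨_, rfl⟩
  obtain ⟨s, hs⟩ : restrict hψ ∈ R.range := htop ▸ Subgroup.mem_top _
  exact ⟨s.toAdd, fun x hx => DFunLike.congr_fun hs (Multiplicative.ofAdd ⟨x, hx⟩)⟩

theorem isClosed_setOf_eqOn (ψ : K → Circle) (k : ℤ) : IsClosed {s | Set.EqOn (χ s) ψ (U k)} := by
  simp only [Set.EqOn, Set.ofPred_forall]
  exact isClosed_biInter fun x _ => isClosed_eq (P.isCharacter_left x).1 continuous_const

theorem isCompact_setOf_eqOn (ψ : K → Circle) (k : ℤ) :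
    IsCompact {s | Set.EqOn (χ s) ψ (U k)} := by
  rcases Set.eq_empty_or_nonempty {s | Set.EqOn (χ s) ψ (U k)} with hempty | ⟨t, ht⟩
  · exact hempty ▸ isCompact_empty
  refine ((P.isCompact_left (-k)).image (continuous_add_const t)).of_isClosed_subset
    (P.isClosed_setOf_eqOn ψ k) fun s hs => ⟨s - t, P.mem_of_eq_one _ _ fun x hx => ?_,
      sub_add_cancel s t⟩
  rw [(P.isCharacter_left x).map_sub, hs hx, ht hx, div_self']

theorem exists_eq {ψ : K → Circle} (hψ : IsCharacter ψ) : ∃ s, χ s = ψ := by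
  have hanti {k l : ℤ} (hkl : k ≤ l) :
      {s | Set.EqOn (χ s) ψ (U k)} ⊆ {s | Set.EqOn (χ s) ψ (U l)} :=
    fun _ hs => hs.mono (P.antitone hkl)
  obtain ⟨s, hs⟩ := IsCompact.nonempty_iInter_of_directed_nonempty_isCompact_isClosed
    (fun k => {s | Set.EqOn (χ s) ψ (U k)})
    (fun k l => ⟨min k l, hanti (min_le_left k l), hanti (min_le_right k l)⟩)
    (P.exists_eqOn hψ) (P.isCompact_setOf_eqOn ψ) (P.isClosed_setOf_eqOn ψ)
  refine ⟨s, funext fun x => ?_⟩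
  obtain ⟨k, hx⟩ := P.exists_mem_right x
  exact Set.mem_iInter.1 hs k hx

theorem isDuality : IsDuality χ where
  map_add_left := P.map_add_left
  map_add_right := P.map_add_right
  continuous_uncurry := P.continuous_uncurry
  exists_eq _ := P.exists_eq
  exists_isCompact W hW := by
    obtain ⟨k, hk⟩ := P.exists_subset_left W hW
    refine ⟨U (-k), P.isCompact_right _, fun s hs => hk ?_⟩
    have hann : ∀ x ∈ U (-k), χ s x = 1 := fun x hx =>
      (P.isCharacter s).eq_one_of_mapsTo_centeredArc hs hx
    simpa only [neg_neg, SetLike.mem_coe] using P.mem_of_eq_one _ s hann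

end IsFilteredPairing

end FilteredPairing

section RealCharacter

theorem IsCharacter.exists_eq_exp_continuousLinearMap {V : Type*} [AddCommGroup V] [Module ℝ V]
    [TopologicalSpace V] [IsTopologicalAddGroup V] [ContinuousSMul ℝ V]
    [LocallyPathConnectedSpace V] {ψ : V → Circle} (hψ : IsCharacter ψ) :
    ∃ f : V →L[ℝ] ℝ, ψ = fun x => Circle.exp (f x) := by
  obtain ⟨θ, ⟨hθ_zero, hθ⟩, hunique⟩ :=
    Circle.isCoveringMap_exp.existsUnique_continuousMap_lifts (⟨ψ, hψ.1⟩ : C(V, Circle)) 0 0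
      (Circle.exp_zero.trans hψ.map_zero.symm)
  have hθ_exp (x : V) : Circle.exp (θ x) = ψ x := congrFun hθ x
  have hθ_add (x y : V) : θ (x + y) = θ x + θ y := by
    let θ' : C(V, ℝ) := ⟨fun x => θ (x + y) - θ y, by fun_prop⟩
    have hθ' : θ' = θ := hunique θ' ⟨by simp [θ'], funext fun x => by
      simp only [Function.comp_apply, θ', ContinuousMap.coe_mk, Circle.exp_sub, hθ_exp, hψ.2,
        mul_div_cancel_right]⟩
    exact sub_eq_iff_eq_add.1 (DFunLike.congr_fun hθ' x)
  let f : V →+ ℝ := { toFun := θ, map_zero' := hθ_zero, map_add' := hθ_add }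
  exact ⟨f.toRealLinearMap θ.continuous, funext fun x => (hθ_exp x).symm⟩

variable {V : Type*} [NormedAddCommGroup V] [InnerProductSpace ℝ V]

theorem IsCharacter.exists_eq_exp_inner [CompleteSpace V] {ψ : V → Circle} (hψ : IsCharacter ψ) :
    ∃ r : V, (fun x => Circle.exp (2 * Real.pi * inner ℝ x r)) = ψ := by
  obtain ⟨f, rfl⟩ := hψ.exists_eq_exp_continuousLinearMap
  refine ⟨(2 * Real.pi)⁻¹ • (InnerProductSpace.toDual ℝ V).symm f, funext fun x => ?_⟩
  rw [inner_smul_right, mul_inv_cancel_left₀ (by positivity), real_inner_comm,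
    InnerProductSpace.toDual_symm_apply]

theorem norm_lt_of_exp_inner_mem_centeredArc {r : V} {ε : ℝ} (hε : 0 < ε)
    (h : Set.MapsTo (fun x => Circle.exp (2 * Real.pi * inner ℝ x r))
      (Metric.closedBall 0 (2 * ε)⁻¹) (Circle.centeredArc (Real.pi / 2))) : ‖r‖ < ε := by
  by_contra! hr
  have hpos : 0 < ‖r‖ := hε.trans_le hr
  have hmem : (2 * ‖r‖ ^ 2)⁻¹ • r ∈ Metric.closedBall 0 (2 * ε)⁻¹ := by
    rw [mem_closedBall_zero_iff, norm_smul, Real.norm_of_nonneg (by positivity)]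
    calc (2 * ‖r‖ ^ 2)⁻¹ * ‖r‖ = (2 * ‖r‖)⁻¹ := by field_simp
      _ ≤ (2 * ε)⁻¹ := by gcongr
  have hpi : 2 * Real.pi * inner ℝ ((2 * ‖r‖ ^ 2)⁻¹ • r) r = Real.pi := by
    rw [real_inner_smul_left, real_inner_self_eq_norm_sq]
    field_simp
  have harc := h hmem
  simp only [hpi] at harc
  rw [Circle.mem_centeredArc (by linarith [Real.pi_pos]), Circle.coe_exp, Complex.exp_pi_mul_I,
    Complex.arg_neg_one, abs_of_pos Real.pi_pos] at harc
  linarith [Real.pi_pos]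

theorem isDuality_exp_inner [FiniteDimensional ℝ V] :
    IsDuality fun r x : V => Circle.exp (2 * Real.pi * inner ℝ x r) where
  map_add_left r r' x := by rw [inner_add_right, mul_add, Circle.exp_add]
  map_add_right r x x' := by rw [inner_add_left, mul_add, Circle.exp_add]
  continuous_uncurry :=
    Circle.exp.continuous.comp (continuous_const.mul (continuous_snd.inner continuous_fst))
  exists_eq _ hψ := by
    have : CompleteSpace V := FiniteDimensional.complete ℝ V
    exact hψ.exists_eq_exp_inner
  exists_isCompact W hW := by
    obtain ⟨ε, hε, hεW⟩ := Metric.nhds_basis_ball.mem_iff.1 hW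
    have : ProperSpace V := FiniteDimensional.proper_real V
    exact ⟨Metric.closedBall 0 (2 * ε)⁻¹, isCompact_closedBall 0 _, fun r hr =>
      hεW (mem_ball_zero_iff.2 (norm_lt_of_exp_inner_mem_centeredArc hε hr))⟩

end RealCharacter

theorem isDuality_realChar : IsDuality (realChar (n := n)) := isDuality_exp_inner

section FiniteIndex

variable {V : Type*} [AddCommGroup V] [Module ℚ V]

theorem exists_natCast_smul_mem_of_mem_span {L : Submodule ℤ V} {x : V}
    (hx : x ∈ Submodule.span ℚ (L : Set V)) : ∃ N : ℕ, N ≠ 0 ∧ (N : ℤ) • x ∈ L := by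
  have := isLocalizedModule_id (R := ℤ) (nonZeroDivisors ℤ) V ℚ
  have hloc := Submodule.localized'_eq_span ℚ (nonZeroDivisors ℤ) (LinearMap.id : V →ₗ[ℤ] V) L
  rw [LinearMap.id_coe, Set.image_id] at hloc
  obtain ⟨y, hy, c, rfl⟩ := (Submodule.mem_localized' ..).1 (hloc ▸ hx)
  have hc : (c : ℤ) • IsLocalizedModule.mk' LinearMap.id y c ∈ L := by
    rwa [← Submonoid.smul_def, IsLocalizedModule.mk'_cancel']
  refine ⟨(c : ℤ).natAbs, Int.natAbs_ne_zero.2 (nonZeroDivisors.coe_ne_zero c), ?_⟩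
  rw [Int.natCast_natAbs]
  rcases abs_choice (c : ℤ) with h | h <;> rw [h]
  · exact hc
  · rw [neg_smul]
    exact neg_mem hc

theorem exists_natCast_smul_mem_of_fg {P L : Submodule ℤ V} (hP : P.FG)
    (hL : Submodule.span ℚ (L : Set V) = ⊤) : ∃ N : ℕ, N ≠ 0 ∧ ∀ x ∈ P, (N : ℤ) • x ∈ L := by
  have hex (x : V) : ∃ N : ℕ, N ≠ 0 ∧ (N : ℤ) • x ∈ L :=
    exists_natCast_smul_mem_of_mem_span (hL ▸ Submodule.mem_top)
  choose N hN hNL using hex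
  obtain ⟨S, rfl⟩ := hP
  refine ⟨∏ x ∈ S, N x, Finset.prod_ne_zero_iff.2 fun x _ => hN x, fun x hx => ?_⟩
  suffices h : Submodule.span ℤ S ≤
      L.comap (LinearMap.lsmul ℤ V ((∏ x ∈ S, N x : ℕ) : ℤ)) from h hx
  refine Submodule.span_le.2 fun y hy => ?_
  obtain ⟨c, hc⟩ := Finset.dvd_prod_of_mem N hy
  change ((∏ x ∈ S, N x : ℕ) : ℤ) • y ∈ L
  rw [hc, mul_comm, Nat.cast_mul, mul_smul]
  exact L.smul_mem _ (hNL y)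

theorem finrank_int_le_finrank_rat [FiniteDimensional ℚ V] (Q : Submodule ℤ V)
    [Module.Finite ℤ Q] : Module.finrank ℤ Q ≤ Module.finrank ℚ V := by
  have : Module.IsTorsionFree ℤ V := Module.IsTorsionFree.trans_faithfulSMul ℤ ℚ V
  have hli := (Module.finBasis ℤ Q).linearIndependent.map' Q.subtype Q.ker_subtype
  simpa using ((LinearIndependent.iff_fractionRing ℤ ℚ).1 hli).fintype_card_le_finrank

theorem card_le_of_incongruent [FiniteDimensional ℚ V] {N : ℕ} (hN : N ≠ 0) (S : Finset V)
    (hS : ∀ x ∈ S, ∀ y ∈ S, (∃ z ∈ Submodule.span ℤ (S : Set V), x - y = (N : ℤ) • z) → x = y) :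
    S.card ≤ N ^ Module.finrank ℚ V := by
  have : NeZero N := ⟨hN⟩
  let Q := Submodule.span ℤ (S : Set V)
  have : Module.Finite ℤ Q := Module.Finite.span_finset ℤ S
  have : Module.IsTorsionFree ℤ V := Module.IsTorsionFree.trans_faithfulSMul ℤ ℚ V
  let b := Module.finBasis ℤ Q
  let toQ (x : S) : Q := ⟨x, Submodule.subset_span x.2⟩
  let coordsMod (x : S) (i : Fin (Module.finrank ℤ Q)) : ZMod N := (b.repr (toQ x) i : ZMod N)
  have hinj : Function.Injective coordsMod := by
    intro x y hxy
    have hdvd (i) : (N : ℤ) ∣ b.repr (toQ x - toQ y) i := by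
      rw [← ZMod.intCast_zmod_eq_zero_iff_dvd, map_sub, Finsupp.sub_apply, Int.cast_sub,
        sub_eq_zero]
      exact congrFun hxy i
    choose c hc using hdvd
    have hsub : toQ x - toQ y = (N : ℤ) • ∑ i, c i • b i := by
      rw [← b.sum_repr (toQ x - toQ y), Finset.smul_sum]
      exact Finset.sum_congr rfl fun i _ => by rw [hc, mul_smul]
    exact Subtype.ext (hS x x.2 y y.2 ⟨_, Subtype.property _, congrArg Subtype.val hsub⟩)
  calc S.card ≤ N ^ Module.finrank ℤ Q := by
        simpa using Fintype.card_le_of_injective coordsMod hinj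
    _ ≤ N ^ Module.finrank ℚ V :=
        Nat.pow_le_pow_right (Nat.pos_of_ne_zero hN) (finrank_int_le_finrank_rat Q)

theorem finite_quotient_of_smul_mem [FiniteDimensional ℚ V] {P G : Submodule ℤ V} {N : ℕ}
    (hN : N ≠ 0) (h : ∀ x ∈ P, (N : ℤ) • x ∈ G) : Finite (P ⧸ G.submoduleOf P) := by
  classical
  by_contra hinf
  rw [not_finite_iff_infinite] at hinf
  obtain ⟨S, hS⟩ :=
    Infinite.exists_subset_card_eq (P ⧸ G.submoduleOf P) (N ^ Module.finrank ℚ V + 1)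
  let rep (q : P ⧸ G.submoduleOf P) : V := (Quotient.out q : P)
  have hrep (q) : rep q ∈ P := Subtype.property _
  have eq_of_sub_mem (q q') (hG : rep q - rep q' ∈ G) : q = q' := by
    rw [← Quotient.out_eq q, ← Quotient.out_eq q']
    exact (Submodule.Quotient.eq (G.submoduleOf P)).2 hG
  have hinj : Function.Injective rep := fun q q' hq => eq_of_sub_mem q q' (by simp [hq])
  have hle := card_le_of_incongruent hN (S.image rep) (by
    intro x hx y hy hxy
    obtain ⟨q, -, rfl⟩ := Finset.mem_image.1 hx
    obtain ⟨q', -, rfl⟩ := Finset.mem_image.1 hy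
    obtain ⟨z, hz, hzN⟩ := hxy
    have hzP : z ∈ P := by
      refine Submodule.span_le.2 ?_ hz
      rw [Finset.coe_image, Set.image_subset_iff]
      exact fun q _ => hrep q
    exact congrArg rep (eq_of_sub_mem q q' (hzN ▸ h z hzP)))
  rw [Finset.card_image_of_injective _ hinj, hS] at hle
  omega

end FiniteIndex

section Filtration

variable {L L' : Submodule ℤ (Fin n → ℚ)} (M : GL (Fin n) ℚ)

variable (L) in
/-- The filtration `Mᵏ L[M]`, `k ∈ ℤ`; for `L = ℤⁿ` it is `fil M`. -/
def polyFil (k : ℤ) : Submodule ℤ (Fin n → ℚ) :=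
  (poly L M).map (act (M ^ k))

variable (L) in
theorem polyFil_zero : polyFil L M 0 = poly L M := by
  ext y
  rw [polyFil, mem_map_act, zpow_zero, inv_one, act_one]

variable (L) in
theorem polyFil_one : polyFil L M 1 = (poly L M).map (act M) := by
  rw [polyFil, zpow_one]

variable {M} in
theorem act_mem_polyFil_add_iff {y : Fin n → ℚ} (j k : ℤ) :
    act (M ^ j) y ∈ polyFil L M (k + j) ↔ y ∈ polyFil L M k := by
  unfold polyFil
  rw [mem_map_act, mem_map_act, ← act_mul, ← zpow_neg, ← zpow_neg, ← zpow_add, neg_add_rev,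
    add_right_comm, neg_add_cancel, zero_add]

variable (L) in
theorem polyFil_antitone : Antitone (polyFil L M) := by
  refine antitone_int_of_succ_le fun k => ?_
  unfold polyFil
  rw [zpow_add_one, ← map_act_map_act]
  exact Submodule.map_mono (map_poly_le _ M)

theorem polyFil_mono (h : L ≤ L') (k : ℤ) : polyFil L M k ≤ polyFil L' M k :=
  Submodule.map_mono (iSup_mono fun _ => Submodule.map_mono h)

variable (L) in
theorem le_poly : L ≤ poly L M :=
  le_sup_left.trans_eq (poly_eq_sup L M).symm

theorem poly_le_laurent : poly (stdLattice n) M ≤ laurent M :=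
  iSup_le fun j => by
    rw [← zpow_natCast]
    exact le_iSup (fun j : ℤ => (stdLattice n).map (act (M ^ j))) j

theorem fil_le_laurent (k : ℤ) : fil M k ≤ laurent M := by
  rintro _ ⟨x, hx, rfl⟩
  exact act_mem_laurent k (poly_le_laurent M hx)

theorem smul_mem_poly {N : ℕ} (h : ∀ x ∈ L', (N : ℤ) • x ∈ L) :
    ∀ x ∈ poly L' M, (N : ℤ) • x ∈ poly L M := by
  intro x hx
  suffices h : poly L' M ≤ (poly L M).comap (LinearMap.lsmul ℤ (Fin n → ℚ) (N : ℤ)) from h hx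
  refine iSup_le fun j => ?_
  rintro _ ⟨z, hz, rfl⟩
  exact le_iSup (fun j : ℕ => L.map (act (M ^ j))) j ⟨_, h z hz, map_smul _ _ _⟩

variable {M} in
theorem act_pow_mem_poly {x : Fin n → ℚ} (j : ℕ) (hx : x ∈ poly L M) :
    act (M ^ j) x ∈ poly L M := by
  induction j with
  | zero => rwa [pow_zero, act_one]
  | succ j ih =>
    rw [pow_succ', act_mul]
    exact map_poly_le L M ⟨_, ih, rfl⟩

/-- A sublattice of `ℤⁿ` of finite index, the index being encoded by a multiple `N` of its
exponent. -/
structure IsFullSublattice (L : Submodule ℤ (Fin n → ℚ)) : Prop where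
  le_std : L ≤ stdLattice n
  exists_smul : ∃ N : ℕ, N ≠ 0 ∧ ∀ x ∈ stdLattice n, (N : ℤ) • x ∈ L

theorem isFullSublattice_std : IsFullSublattice (stdLattice n) :=
  ⟨le_rfl, 1, one_ne_zero, fun x hx => by simpa using hx⟩

variable (L) in
/-- Multiplication by `M` on `ℤⁿ[M] / L[M]`. -/
def quotientMul :
    Module.End ℤ (poly (stdLattice n) M ⧸ (poly L M).submoduleOf (poly (stdLattice n) M)) :=
  Submodule.mapQ _ _
    ((act M).restrict fun x hx => map_poly_le (stdLattice n) M ⟨x, hx, rfl⟩)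
    fun x hx => map_poly_le L M ⟨x.1, hx, rfl⟩

theorem quotientMul_pow_mk (j : ℕ) (x : poly (stdLattice n) M) :
    (quotientMul L M ^ j) (Submodule.Quotient.mk x) =
      Submodule.Quotient.mk ⟨act (M ^ j) x.1, act_pow_mem_poly j x.2⟩ := by
  induction j with
  | zero => simp [act_one]
  | succ j ih =>
    rw [pow_succ', Module.End.mul_apply, ih]
    simp only [pow_succ', act_mul]
    rfl

theorem IsFullSublattice.finite_quotient (hL : IsFullSublattice L) :
    Finite (poly (stdLattice n) M ⧸ (poly L M).submoduleOf (poly (stdLattice n) M)) := by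
  obtain ⟨N, hN, hNL⟩ := hL.exists_smul
  exact finite_quotient_of_smul_mem hN (smul_mem_poly M hNL)

theorem IsFullSublattice.exists_act_pow_mem (hL : IsFullSublattice L) :
    ∃ m : ℕ, ∀ j, ∀ x ∈ poly (stdLattice n) M,
      act (M ^ j) x ∈ poly L M → act (M ^ m) x ∈ poly L M := by
  have := hL.finite_quotient M
  obtain ⟨m, hm⟩ := (quotientMul L M).eventually_iSup_ker_pow_eq.exists
  have hmk (j x) (hx : x ∈ poly (stdLattice n) M) : act (M ^ j) x ∈ poly L M ↔
      Submodule.Quotient.mk ⟨x, hx⟩ ∈ LinearMap.ker (quotientMul L M ^ j) := by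
    rw [LinearMap.mem_ker, quotientMul_pow_mk, Submodule.Quotient.mk_eq_zero]
    rfl
  refine ⟨m, fun j x hx hj => ?_⟩
  rw [hmk _ _ hx] at hj ⊢
  exact hm ▸ le_iSup (fun j => LinearMap.ker (quotientMul L M ^ j)) j hj

theorem IsFullSublattice.exists_act_pow_sub_mem (hL : IsFullSublattice L) :
    ∃ m : ℕ, ∀ i : ℕ, ∀ x ∈ poly (stdLattice n) M, ∃ z ∈ poly (stdLattice n) M,
      act (M ^ m) x - act (M ^ (m + i)) z ∈ poly L M := by
  have := hL.finite_quotient M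
  obtain ⟨m, hm⟩ := (quotientMul L M).eventually_iInf_range_pow_eq.exists
  refine ⟨m, fun i x hx => ?_⟩
  have hrange := LinearMap.mem_range_self (quotientMul L M ^ m) (Submodule.Quotient.mk ⟨x, hx⟩)
  rw [← hm] at hrange
  obtain ⟨q, hq⟩ := iInf_le (fun j => LinearMap.range (quotientMul L M ^ j)) (m + i) hrange
  obtain ⟨⟨z, hz⟩, rfl⟩ := Submodule.Quotient.mk_surjective _ q
  rw [eq_comm, quotientMul_pow_mk, quotientMul_pow_mk, Submodule.Quotient.eq] at hq
  exact ⟨z, hz, hq⟩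

theorem IsFullSublattice.exists_polyFil_inf_fil_le (hL : IsFullSublattice L) :
    ∃ m : ℕ, ∀ j k : ℤ, polyFil L M j ⊓ fil M k ≤ polyFil L M (k - m) := by
  obtain ⟨m, hm⟩ := hL.exists_act_pow_mem M
  refine ⟨m, fun j k => ?_⟩
  rintro _ ⟨hj, x, hx, rfl⟩
  have hxj : x ∈ polyFil L M (j - k) := by
    rwa [← act_mem_polyFil_add_iff k, sub_add_cancel]
  have hpow : act (M ^ (j - k).natAbs) x ∈ poly L M := by
    rw [← polyFil_zero, ← zpow_natCast]
    exact polyFil_antitone L M (by omega)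
      ((act_mem_polyFil_add_iff ((j - k).natAbs : ℤ) (j - k)).2 hxj)
  have hxm := hm _ x hx hpow
  rwa [← polyFil_zero, ← zpow_natCast, ← neg_add_cancel (m : ℤ), act_mem_polyFil_add_iff,
    ← act_mem_polyFil_add_iff k, neg_add_eq_sub] at hxm

theorem IsFullSublattice.exists_fil_le_polyFil_sup (hL : IsFullSublattice L) :
    ∃ m : ℕ, ∀ k l : ℤ, fil M k ≤ polyFil L M (k - m) ⊔ fil M l := by
  obtain ⟨m, hm⟩ := hL.exists_act_pow_sub_mem M
  refine ⟨m, fun k l => ?_⟩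
  rintro _ ⟨x, hx, rfl⟩
  obtain ⟨z, hz, hxz⟩ := hm (l - k).natAbs x hx
  refine Submodule.mem_sup.2 ⟨_, ⟨_, hxz, rfl⟩, act (M ^ (k + (l - k).natAbs)) z,
    fil_antitone M (by omega) ⟨z, hz, rfl⟩, ?_⟩
  rw [map_sub, ← act_mul, ← act_mul, ← zpow_natCast, ← zpow_natCast, ← zpow_add, ← zpow_add,
    sub_add_cancel, Nat.cast_add, ← add_assoc, sub_add_cancel, sub_add_cancel]

variable {M} in
theorem exists_le_fil_of_fg {W : Submodule ℤ (Fin n → ℚ)} (hW : W.FG) (hWM : W ≤ laurent M) :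
    ∃ k, W ≤ fil M k := by
  obtain ⟨S, rfl⟩ := hW
  have hex : ∀ x ∈ S, ∃ k, x ∈ fil M k := fun x hx =>
    exists_mem_fil (hWM (Submodule.subset_span hx))
  choose! κ hκ using hex
  obtain ⟨k, hk⟩ := (S.image κ).bddBelow
  exact ⟨k, Submodule.span_le.2 fun x hx =>
    fil_antitone M (hk (Finset.mem_coe.2 (Finset.mem_image_of_mem κ hx))) (hκ x hx)⟩

theorem stdLattice_fg : (stdLattice n).FG := by
  rw [stdLattice, LinearMap.range_eq_map]
  exact (Module.Finite.fg_top).map _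

theorem exists_fil_of_smul_mem_std {N : ℕ} (hN : N ≠ 0) :
    ∃ k : ℤ, ∀ x ∈ laurent M, (N : ℤ) • x ∈ stdLattice n → x ∈ fil M k := by
  let mulN : (Fin n → ℚ) →ₗ[ℤ] (Fin n → ℚ) := LinearMap.lsmul ℤ (Fin n → ℚ) (N : ℤ)
  have hinj : Function.Injective mulN := smul_right_injective _ (Nat.cast_ne_zero.2 hN)
  have hfg : (laurent M ⊓ (stdLattice n).comap mulN).FG := by
    refine Submodule.fg_of_fg_map_injective mulN hinj ?_
    exact stdLattice_fg.of_le (Submodule.map_le_iff_le_comap.2 inf_le_right)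
  obtain ⟨k, hk⟩ := exists_le_fil_of_fg hfg inf_le_left
  exact ⟨k, fun x hx hNx => hk ⟨hx, hNx⟩⟩

end Filtration

section Completion

variable {L L' : Submodule ℤ (Fin n → ℚ)} {M : GL (Fin n) ℚ}

variable (M) in
/-- The inclusion `ℤⁿ(M) → ℚⁿ`. -/
def laurentVal : LaurentGroup M →+ (Fin n → ℚ) where
  toFun y := y.1
  map_zero' := rfl
  map_add' _ _ := rfl

/-- An element of `ℤⁿ(M) ⊆ ℚⁿ` as an element of the metric group `ℤⁿ(M)`. -/
def ofLaurent {x : Fin n → ℚ} (hx : x ∈ laurent M) : LaurentGroup M := ⟨x, hx⟩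

theorem laurentVal_ofLaurent {x : Fin n → ℚ} (hx : x ∈ laurent M) :
    laurentVal M (ofLaurent hx) = x := rfl

variable (M) in
theorem laurentVal_injective : Function.Injective (laurentVal M) :=
  fun _ _ h => Subtype.ext h

theorem laurentVal_mem (x : LaurentGroup M) : laurentVal M x ∈ laurent M := x.2

theorem laurentVal_laurentMul (j : ℤ) (x : LaurentGroup M) :
    laurentVal M (laurentMul M j x) = act (M ^ j) (laurentVal M x) := rfl

theorem norm_eq_adicNorm (x : LaurentGroup M) : ‖x‖ = adicNorm M (laurentVal M x) := rfl

variable (M) in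
/-- The inclusion `ℤⁿ(M) → ℤⁿ((M))`. -/
def toSeries : LaurentGroup M →+ Series M := Completion.toCompl

theorem monomial_eq_toSeries (j : ℤ) (z : Fin n → ℤ) :
    monomial M j z = toSeries M (ofLaurent (act_intVec_mem_laurent M j z)) := rfl

variable (L M) in
/-- `Mᵏ L[M] ∩ ℤⁿ(M)` as a subgroup of the metric group `ℤⁿ(M)`. -/
def laurentFil (k : ℤ) : AddSubgroup (LaurentGroup M) :=
  (polyFil L M k).toAddSubgroup.comap (laurentVal M)

variable (L M) in
/-- The closure of `Mᵏ L[M]` in `ℤⁿ((M))`. -/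
def seriesFil (k : ℤ) : AddSubgroup (Series M) :=
  ((laurentFil L M k).map (toSeries M)).topologicalClosure

theorem fil_le_fil_succ_of_residueCard_eq_one (h : residueCard M = 1) (k : ℤ) :
    fil M k ≤ fil M (k + 1) := by
  have hle : poly (stdLattice n) M ≤ (poly (stdLattice n) M).map (act M) :=
    AddSubgroup.relIndex_eq_one.1 h
  unfold fil
  rw [zpow_add_one, ← map_act_map_act]
  exact Submodule.map_mono hle

theorem adicNorm_eq_zero_of_residueCard_eq_one (h : residueCard M = 1) (x : Fin n → ℚ) :
    adicNorm M x = 0 := by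
  have hv : valuation M x = ⊤ := dif_neg fun ⟨k, hk, hk'⟩ =>
    hk' (fil_le_fil_succ_of_residueCard_eq_one h k hk)
  rw [adicNorm, hv]
  rfl

theorem adicNorm_le_of_mem_fil {k : ℤ} {x : Fin n → ℚ} (hx : x ∈ fil M k) :
    adicNorm M x ≤ (residueCard M : ℝ) ^ (-k) := by
  unfold adicNorm
  cases hv : valuation M x with
  | top => exact zpow_nonneg (Nat.cast_nonneg _) _
  | coe j =>
    have hj : x ∉ fil M (j + 1) := (valuation_eq_coe_iff.1 hv).2
    refine zpow_le_zpow_right₀ (one_le_residueCard M) (neg_le_neg ?_)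
    by_contra! hlt
    exact hj (fil_antitone M (by omega) hx)

theorem mem_fil_of_adicNorm_lt {k : ℤ} {x : Fin n → ℚ} (hx : x ∈ laurent M)
    (h : adicNorm M x < (residueCard M : ℝ) ^ (-k)) : x ∈ fil M (k + 1) := by
  by_contra hk
  obtain ⟨j, hj, hv⟩ := exists_valuation_le hx hk
  refine h.not_ge ?_
  rw [adicNorm, hv]
  exact zpow_le_zpow_right₀ (one_le_residueCard M) (neg_le_neg hj)

variable (M) in
theorem exists_forall_mem_fil_adicNorm_lt {ε : ℝ} (hε : 0 < ε) :
    ∃ k : ℤ, ∀ x ∈ fil M k, adicNorm M x < ε := by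
  by_cases hb : residueCard M = 1
  · exact ⟨0, fun x _ => (adicNorm_eq_zero_of_residueCard_eq_one hb x).trans_lt hε⟩
  · have hb' : (1 : ℝ) < residueCard M := by
      exact_mod_cast (Nat.one_lt_iff_ne_zero_and_ne_one.2 ⟨residueCard_ne_zero M, hb⟩)
    obtain ⟨k, hk⟩ := exists_pow_lt_of_lt_one hε (inv_lt_one_of_one_lt₀ hb')
    refine ⟨k, fun x hx => (adicNorm_le_of_mem_fil hx).trans_lt ?_⟩
    rwa [zpow_neg, zpow_natCast, ← inv_pow]

variable (M) in
theorem hasBasis_nhds_zero_laurentGroup :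
    (𝓝 (0 : LaurentGroup M)).HasBasis (fun _ : ℤ => True)
      fun k => (laurentFil (stdLattice n) M k : Set (LaurentGroup M)) := by
  refine Metric.nhds_basis_ball.to_hasBasis (fun ε hε => ?_) fun k _ => ?_
  · obtain ⟨k, hk⟩ := exists_forall_mem_fil_adicNorm_lt M hε
    exact ⟨k, trivial, fun x hx => mem_ball_zero_iff.2 (hk _ hx)⟩
  · refine ⟨(residueCard M : ℝ) ^ (-(k - 1)),
      zpow_pos (zero_lt_one.trans_le (one_le_residueCard M)) _, fun x hx => ?_⟩
    rw [mem_ball_zero_iff, norm_eq_adicNorm] at hx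
    have hk := mem_fil_of_adicNorm_lt (laurentVal_mem x) hx
    rwa [sub_add_cancel] at hk

variable (M) in
theorem hasBasis_nhds_zero :
    (𝓝 (0 : Series M)).HasBasis (fun _ : ℤ => True)
      fun k => (seriesFil (stdLattice n) M k : Set (Series M)) :=
  (hasBasis_nhds_zero_laurentGroup M).hasBasis_of_isDenseInducing Completion.isDenseInducing_coe

theorem toSeries_mem_seriesFil {k : ℤ} {x : LaurentGroup M} (hx : laurentVal M x ∈ polyFil L M k) :
    toSeries M x ∈ seriesFil L M k :=
  subset_closure ⟨x, hx, rfl⟩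

theorem isClosed_seriesFil (k : ℤ) : IsClosed (seriesFil L M k : Set (Series M)) :=
  AddSubgroup.isClosed_topologicalClosure _

theorem isOpen_seriesFil_std (k : ℤ) : IsOpen (seriesFil (stdLattice n) M k : Set (Series M)) :=
  AddSubgroup.isOpen_of_mem_nhds _ ((hasBasis_nhds_zero M).mem_of_mem trivial)

variable (L M) in
theorem seriesFil_antitone : Antitone (seriesFil L M) :=
  fun _ _ h => closure_mono (Set.image_mono fun _ hx => polyFil_antitone L M h hx)

theorem seriesFil_mono (h : L ≤ L') (k : ℤ) : seriesFil L M k ≤ seriesFil L' M k :=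
  closure_mono (Set.image_mono fun _ hx => polyFil_mono M h k hx)

theorem toSeries_mem_seriesFil_std_iff {k : ℤ} {x : LaurentGroup M} :
    toSeries M x ∈ seriesFil (stdLattice n) M k ↔ laurentVal M x ∈ fil M k := by
  refine ⟨fun h => ?_, toSeries_mem_seriesFil⟩
  have hind : IsInducing (toSeries M) := (Completion.isDenseInducing_coe (α := LaurentGroup M)).1
  have hopen : IsOpen (laurentFil (stdLattice n) M k : Set (LaurentGroup M)) :=
    AddSubgroup.isOpen_of_mem_nhds _ ((hasBasis_nhds_zero_laurentGroup M).mem_of_mem trivial)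
  have hx : x ∈ closure (laurentFil (stdLattice n) M k : Set (LaurentGroup M)) := by
    rw [hind.closure_eq_preimage_closure_image]
    exact h
  rwa [(AddSubgroup.isClosed_of_isOpen _ hopen).closure_eq] at hx

theorem exists_sub_toSeries_mem_seriesFil_std {S : Set (LaurentGroup M)} {y : Series M}
    (hy : y ∈ closure (toSeries M '' S)) (k : ℤ) :
    ∃ x ∈ S, y - toSeries M x ∈ seriesFil (stdLattice n) M k := by
  have hnhds : {z | y - z ∈ seriesFil (stdLattice n) M k} ∈ 𝓝 y := by
    refine (continuous_sub_left _).continuousAt.preimage_mem_nhds ?_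
    rw [sub_self]
    exact (hasBasis_nhds_zero M).mem_of_mem trivial
  obtain ⟨_, hx', x, hx, rfl⟩ := mem_closure_iff_nhds.1 hy _ hnhds
  exact ⟨x, hx, hx'⟩

theorem exists_mem_seriesFil_std (y : Series M) : ∃ k, y ∈ seriesFil (stdLattice n) M k := by
  obtain ⟨x, -, hx⟩ := exists_sub_toSeries_mem_seriesFil_std (S := Set.univ) (y := y)
    (by rw [Set.image_univ]; exact Completion.denseRange_coe y) 0
  obtain ⟨k, hk⟩ := exists_mem_fil (laurentVal_mem x)
  refine ⟨min 0 k, ?_⟩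
  rw [← sub_add_cancel y (toSeries M x)]
  exact add_mem (seriesFil_antitone _ M (min_le_left _ _) hx)
    (seriesFil_antitone _ M (min_le_right _ _) (toSeries_mem_seriesFil hk))

theorem eq_zero_of_forall_mem_seriesFil_std {y : Series M}
    (h : ∀ k, y ∈ seriesFil (stdLattice n) M k) : y = 0 := by
  by_contra hy
  obtain ⟨k, -, hk⟩ := (hasBasis_nhds_zero M).mem_iff.1 (isOpen_ne.mem_nhds (Ne.symm hy))
  exact hk (h k) rfl

variable (M) in
theorem IsFullSublattice.exists_seriesFil_std_le (hL : IsFullSublattice L) :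
    ∃ m : ℕ, ∀ k, seriesFil (stdLattice n) M k ≤ seriesFil L M (k - m) := by
  obtain ⟨m, hm⟩ := hL.exists_fil_le_polyFil_sup M
  refine ⟨m, fun k => AddSubgroup.topologicalClosure_minimal _ ?_ (isClosed_seriesFil _)⟩
  rintro _ ⟨x, hx, rfl⟩
  refine mem_closure_iff_nhds.2 fun t ht => ?_
  have hnhds : (fun z => toSeries M x - z) ⁻¹' t ∈ 𝓝 (0 : Series M) := by
    refine (continuous_sub_left _).continuousAt.preimage_mem_nhds ?_
    rwa [sub_zero]
  obtain ⟨l, -, hl⟩ := (hasBasis_nhds_zero M).mem_iff.1 hnhds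
  obtain ⟨g, hg, r, hr, hgr⟩ := Submodule.mem_sup.1 (hm k l hx)
  have hxr : laurentVal M (x - ofLaurent (fil_le_laurent M l hr)) ∈ polyFil L M (k - m) := by
    rwa [map_sub, laurentVal_ofLaurent, ← hgr, add_sub_cancel_right]
  refine ⟨_, ?_, _, hxr, rfl⟩
  rw [map_sub]
  exact hl (toSeries_mem_seriesFil hr)

theorem IsFullSublattice.exists_mem_seriesFil (hL : IsFullSublattice L) (y : Series M) :
    ∃ k, y ∈ seriesFil L M k := by
  obtain ⟨m, hm⟩ := hL.exists_seriesFil_std_le M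
  obtain ⟨k, hk⟩ := exists_mem_seriesFil_std y
  exact ⟨_, hm k hk⟩

theorem IsFullSublattice.exists_sub_toSeries_mem_seriesFil (hL : IsFullSublattice L)
    {y : Series M} {j : ℤ} (hy : y ∈ seriesFil L M j) (k : ℤ) :
    ∃ x, laurentVal M x ∈ polyFil L M j ∧ y - toSeries M x ∈ seriesFil L M k := by
  obtain ⟨m, hm⟩ := hL.exists_seriesFil_std_le M
  obtain ⟨x, hx, hxk⟩ := exists_sub_toSeries_mem_seriesFil_std hy (k + m)
  refine ⟨x, hx, ?_⟩
  simpa only [add_sub_cancel_right] using hm _ hxk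

theorem IsFullSublattice.mem_polyFil_of_toSeries_mem (hL : IsFullSublattice L)
    {x : LaurentGroup M} {j k : ℤ} (hx : laurentVal M x ∈ polyFil L M j)
    (h : toSeries M x ∈ seriesFil L M k) : laurentVal M x ∈ polyFil L M k := by
  obtain ⟨m, hm⟩ := hL.exists_polyFil_inf_fil_le M
  obtain ⟨g, hg, h⟩ := exists_sub_toSeries_mem_seriesFil_std h (k + m)
  rw [← map_sub, toSeries_mem_seriesFil_std_iff, map_sub] at h
  have hsub : laurentVal M x - laurentVal M g ∈ polyFil L M (min j k) :=
    sub_mem (polyFil_antitone L M (min_le_left _ _) hx)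
      (polyFil_antitone L M (min_le_right _ _) hg)
  have hsub' := hm _ _ ⟨hsub, h⟩
  rw [add_sub_cancel_right] at hsub'
  exact (Submodule.sub_mem_iff_left _ hg).1 hsub'

theorem seriesMul_toSeries (j : ℤ) (x : LaurentGroup M) :
    seriesMul M j (toSeries M x) = toSeries M (laurentMul M j x) :=
  AddMonoidHom.completion_coe _ (continuous_laurentMul M j) x

variable (M) in
theorem continuous_seriesMul (j : ℤ) : Continuous (seriesMul M j) :=
  AddMonoidHom.continuous_completion _ (continuous_laurentMul M j)

theorem seriesMul_seriesMul (i j : ℤ) (y : Series M) :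
    seriesMul M i (seriesMul M j y) = seriesMul M (i + j) y := by
  induction y using Completion.induction_on with
  | hp =>
    exact isClosed_eq ((continuous_seriesMul M i).comp (continuous_seriesMul M j))
      (continuous_seriesMul M _)
  | ih x =>
    change seriesMul M i (seriesMul M j (toSeries M x)) = seriesMul M (i + j) (toSeries M x)
    rw [seriesMul_toSeries, seriesMul_toSeries, seriesMul_toSeries]
    congr 1
    apply laurentVal_injective
    rw [laurentVal_laurentMul, laurentVal_laurentMul, laurentVal_laurentMul, ← act_mul, ← zpow_add]

theorem seriesMul_zero (y : Series M) : seriesMul M 0 y = y := by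
  induction y using Completion.induction_on with
  | hp => exact isClosed_eq (continuous_seriesMul M 0) continuous_id
  | ih x =>
    change seriesMul M 0 (toSeries M x) = toSeries M x
    rw [seriesMul_toSeries]
    congr 1
    apply laurentVal_injective
    rw [laurentVal_laurentMul, zpow_zero, act_one]

theorem seriesMul_monomial (i j : ℤ) (z : Fin n → ℤ) :
    seriesMul M i (monomial M j z) = monomial M (i + j) z := by
  rw [monomial_eq_toSeries, monomial_eq_toSeries, seriesMul_toSeries]
  congr 1
  apply laurentVal_injective
  rw [laurentVal_laurentMul, laurentVal_ofLaurent, laurentVal_ofLaurent, ← act_mul, ← zpow_add]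

theorem seriesMul_mem_seriesFil {j k : ℤ} {y : Series M} (hy : y ∈ seriesFil L M k) :
    seriesMul M j y ∈ seriesFil L M (k + j) := by
  refine map_mem_closure (continuous_seriesMul M j) hy ?_
  rintro _ ⟨x, hx, rfl⟩
  rw [seriesMul_toSeries]
  exact ⟨_, (act_mem_polyFil_add_iff j k).2 hx, rfl⟩

theorem seriesMul_mem_seriesFil_iff {j k : ℤ} {y : Series M} :
    seriesMul M j y ∈ seriesFil L M (k + j) ↔ y ∈ seriesFil L M k := by
  refine ⟨fun h => ?_, seriesMul_mem_seriesFil⟩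
  have hinv := seriesMul_mem_seriesFil (j := -j) h
  rwa [seriesMul_seriesMul, neg_add_cancel, seriesMul_zero, add_neg_cancel_right] at hinv

theorem exists_finite_cover_seriesFil_succ (k : ℤ) :
    ∃ T : Set (Series M), T.Finite ∧ ∀ y ∈ seriesFil (stdLattice n) M k, ∃ t ∈ T,
      y - t ∈ seriesFil (stdLattice n) M (k + 1) := by
  let P := poly (stdLattice n) M
  let H := (P.map (act M)).submoduleOf P
  have : Finite (P ⧸ H) := Nat.finite_of_card_ne_zero (residueCard_ne_zero M)
  let rep (q : P ⧸ H) : Series M :=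
    toSeries M (ofLaurent (act_mem_laurent k (poly_le_laurent M (Quotient.out q : P).2)))
  refine ⟨Set.range rep, Set.finite_range rep, fun y hy => ?_⟩
  obtain ⟨x, ⟨p, hp, hpx⟩, hxy⟩ :=
    isFullSublattice_std.exists_sub_toSeries_mem_seriesFil hy (k + 1)
  let q : P ⧸ H := Submodule.Quotient.mk ⟨p, hp⟩
  refine ⟨rep q, ⟨q, rfl⟩, ?_⟩
  have hpq : p - (Quotient.out q : P) ∈ polyFil (stdLattice n) M 1 := by
    rw [polyFil_one]
    exact (Submodule.Quotient.eq H).1 (Quotient.out_eq q).symm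
  have hxq : toSeries M x - rep q ∈ seriesFil (stdLattice n) M (k + 1) := by
    rw [← map_sub]
    refine toSeries_mem_seriesFil ?_
    rw [map_sub, laurentVal_ofLaurent, ← hpx, ← map_sub, add_comm]
    exact (act_mem_polyFil_add_iff k 1).2 hpq
  simpa only [sub_add_sub_cancel] using add_mem hxy hxq

theorem exists_finite_cover_seriesFil_add (k : ℤ) (d : ℕ) :
    ∃ T : Set (Series M), T.Finite ∧ ∀ y ∈ seriesFil (stdLattice n) M k, ∃ t ∈ T,
      y - t ∈ seriesFil (stdLattice n) M (k + d) := by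
  induction d with
  | zero => exact ⟨{0}, Set.finite_singleton 0, fun y hy => ⟨0, rfl, by simpa using hy⟩⟩
  | succ d ih =>
    obtain ⟨T, hT, h⟩ := ih
    obtain ⟨T', hT', h'⟩ := exists_finite_cover_seriesFil_succ (M := M) (k + d)
    refine ⟨Set.image2 (· + ·) T T', hT.image2 _ hT', fun y hy => ?_⟩
    obtain ⟨t, ht, hyt⟩ := h y hy
    obtain ⟨t', ht', hyt'⟩ := h' _ hyt
    refine ⟨_, ⟨t, ht, t', ht', rfl⟩, ?_⟩
    rw [Nat.cast_succ, ← add_assoc, ← sub_sub]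
    exact hyt'

theorem isCompact_seriesFil_std (k : ℤ) :
    IsCompact (seriesFil (stdLattice n) M k : Set (Series M)) := by
  refine TotallyBounded.isCompact_of_isClosed ?_ (isClosed_seriesFil k)
  rw [totallyBounded_iff_subset_finite_iUnion_nhds_zero]
  intro U hU
  obtain ⟨l, -, hl⟩ := (hasBasis_nhds_zero M).mem_iff.1 hU
  obtain ⟨T, hT, h⟩ := exists_finite_cover_seriesFil_add (M := M) k (l - k).toNat
  refine ⟨T, hT, fun y hy => ?_⟩
  obtain ⟨t, ht, hyt⟩ := h y hy
  refine Set.mem_biUnion ht ⟨y - t, hl (seriesFil_antitone _ M (by omega) hyt), ?_⟩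
  exact add_sub_cancel t y

theorem monomial_sub (j : ℤ) (z z' : Fin n → ℤ) :
    monomial M j (z - z') = monomial M j z - monomial M j z' := by
  rw [monomial_eq_toSeries, monomial_eq_toSeries, monomial_eq_toSeries, ← map_sub]
  congr 1
  apply laurentVal_injective
  change act (M ^ j) (intVec n (z - z')) =
    act (M ^ j) (intVec n z) - act (M ^ j) (intVec n z')
  rw [map_sub, map_sub]

theorem monomial_zero (j : ℤ) : monomial M j 0 = 0 := by
  simpa only [sub_self] using monomial_sub (M := M) j 0 0

theorem act_mem_polyFil {x : Fin n → ℚ} (hx : x ∈ poly L M) (j : ℤ) :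
    act (M ^ j) x ∈ polyFil L M j :=
  ⟨x, hx, rfl⟩

theorem monomial_mem_seriesFil {z : Fin n → ℤ} (hz : intVec n z ∈ L) (j : ℤ) :
    monomial M j z ∈ seriesFil L M j :=
  toSeries_mem_seriesFil (act_mem_polyFil (le_poly L M hz) j)

theorem act_zpow_mem_poly_inv {x : Fin n → ℚ} (hx : x ∈ L) {j : ℤ} (hj : j ≤ 0) :
    act (M ^ j) x ∈ poly L M⁻¹ := by
  refine le_iSup (fun j : ℕ => L.map (act (M⁻¹ ^ j))) (-j).toNat ⟨x, hx, ?_⟩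
  rw [inv_pow, ← zpow_natCast, ← zpow_neg, Int.toNat_of_nonneg (by omega), neg_neg]

end Completion

section Expansion

variable {L : Submodule ℤ (Fin n → ℚ)} {M : GL (Fin n) ℚ} {E : Set (Fin n → ℤ)}

theorem sum_monomial_sub_sum_Ico_mem {N k : ℤ} {d : ℤ → Fin n → ℤ} {s : Finset ℤ}
    (hd : ∀ j, intVec n (d j) ∈ L) (h0 : ∀ j < N, d j = 0) (hs : Finset.Ico N k ⊆ s) :
    ∑ j ∈ s, monomial M j (d j) - ∑ j ∈ Finset.Ico N k, monomial M j (d j) ∈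
      seriesFil L M k := by
  rw [← Finset.sum_sdiff hs, add_sub_cancel_right]
  refine sum_mem fun j hj => ?_
  rw [Finset.mem_sdiff, Finset.mem_Ico, not_and, not_lt] at hj
  rcases lt_or_ge j N with hjN | hjN
  · rw [h0 j hjN, monomial_zero]
    exact zero_mem _
  · exact seriesFil_antitone L M (hj.2 hjN) (monomial_mem_seriesFil (hd j) j)

theorem IsFullSublattice.hasSum_monomial_iff (hL : IsFullSublattice L) {N : ℤ}
    {d : ℤ → Fin n → ℤ} {y : Series M} (hd : ∀ j, intVec n (d j) ∈ L) (h0 : ∀ j < N, d j = 0) :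
    HasSum (fun j => monomial M j (d j)) y ↔
      ∀ k, y - ∑ j ∈ Finset.Ico N k, monomial M j (d j) ∈ seriesFil L M k := by
  refine ⟨fun h k => ?_, fun h => ?_⟩
  · refine (isClosed_seriesFil k).mem_of_tendsto (Tendsto.sub_const h _) ?_
    exact (eventually_ge_atTop (Finset.Ico N k)).mono fun s hs =>
      sum_monomial_sub_sum_Ico_mem hd h0 hs
  · refine tendsto_iff_forall_eventually_mem.2 fun U hU => ?_
    have hnhds : (fun z => y - z) ⁻¹' U ∈ 𝓝 (0 : Series M) := by
      refine (continuous_sub_left _).continuousAt.preimage_mem_nhds ?_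
      rwa [sub_zero]
    obtain ⟨k, -, hk⟩ := (hasBasis_nhds_zero M).mem_iff.1 hnhds
    refine (eventually_ge_atTop (Finset.Ico N k)).mono fun s hs => ?_
    have hsub := sub_mem (h k) (sum_monomial_sub_sum_Ico_mem hd h0 hs)
    rw [sub_sub_sub_cancel_right] at hsub
    simpa only [Set.mem_preimage, sub_sub_cancel] using hk (seriesFil_mono hL.le_std k hsub)

theorem exists_mem_polyFil_of_mem_poly_inv {x : Fin n → ℚ} (hx : x ∈ poly L M⁻¹) :
    ∃ j, x ∈ polyFil L M j := by
  have hdir : Directed (· ≤ ·) (polyFil L M) := (polyFil_antitone L M).directed_le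
  refine (Submodule.mem_iSup_of_directed _ hdir).1 ((iSup_le fun j => ?_ :
    poly L M⁻¹ ≤ ⨆ k, polyFil L M k) hx)
  rintro _ ⟨z, hz, rfl⟩
  refine le_iSup (fun k => polyFil L M k) (-j : ℤ) ⟨z, le_poly L M hz, ?_⟩
  rw [zpow_neg, zpow_natCast, inv_pow]

/-- The data of a digit expansion: a sublattice `L` of `ℤⁿ` of finite index, and a digit set `E`
for it and `M`. -/
structure IsDigitSystem (L : Submodule ℤ (Fin n → ℚ)) (M : GL (Fin n) ℚ)
    (E : Set (Fin n → ℤ)) : Prop where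
  full : IsFullSublattice L
  residue : IsResidueSystem L M E

namespace IsDigitSystem

variable (D : IsDigitSystem L M E)

include D

theorem intVec_mem {e : Fin n → ℤ} (he : e ∈ E) : intVec n e ∈ L := D.residue.1 e he

theorem zero_mem : (0 : Fin n → ℤ) ∈ E := D.residue.2.1

theorem exists_digit {y : Series M} {j : ℤ} (hy : y ∈ seriesFil L M j) :
    ∃ e ∈ E, y - monomial M j e ∈ seriesFil L M (j + 1) := by
  obtain ⟨x, ⟨p, hp, hpx⟩, hyx⟩ := D.full.exists_sub_toSeries_mem_seriesFil hy (j + 1)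
  obtain ⟨e, ⟨he, hpe⟩, -⟩ := D.residue.2.2 p hp
  refine ⟨e, he, ?_⟩
  rw [← polyFil_one, ← act_mem_polyFil_add_iff j, map_sub, hpx, add_comm] at hpe
  have hxe : toSeries M x - monomial M j e ∈ seriesFil L M (j + 1) := by
    rw [monomial_eq_toSeries, ← map_sub]
    exact toSeries_mem_seriesFil hpe
  simpa only [sub_add_sub_cancel] using add_mem hyx hxe

theorem digit_unique {e e' : Fin n → ℤ} {j : ℤ} (he : e ∈ E) (he' : e' ∈ E)
    (h : monomial M j e - monomial M j e' ∈ seriesFil L M (j + 1)) : e = e' := by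
  have hz : intVec n (e - e') ∈ L := by
    rw [map_sub]
    exact sub_mem (D.intVec_mem he) (D.intVec_mem he')
  rw [← monomial_sub, monomial_eq_toSeries] at h
  have hmem := D.full.mem_polyFil_of_toSeries_mem (act_mem_polyFil (le_poly L M hz) j) h
  rw [laurentVal_ofLaurent, add_comm, act_mem_polyFil_add_iff, polyFil_one, map_sub] at hmem
  refine (D.residue.2.2 _ (le_poly L M (D.intVec_mem he))).unique ⟨he, ?_⟩ ⟨he', hmem⟩
  rw [sub_self]
  exact Submodule.zero_mem _

theorem exists_greedy_digits {y : Series M} {N : ℤ} (hy : y ∈ seriesFil L M N) :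
    ∃ e : ℕ → Fin n → ℤ, (∀ i, e i ∈ E) ∧ ∀ k : ℕ,
      y - ∑ i ∈ Finset.range k, monomial M (N + i) (e i) ∈ seriesFil L M (N + k) := by
  have hdigit (j : ℤ) (z : Series M) :
      ∃ e ∈ E, z ∈ seriesFil L M j → z - monomial M j e ∈ seriesFil L M (j + 1) := by
    by_cases hz : z ∈ seriesFil L M j
    · obtain ⟨e, he, hze⟩ := D.exists_digit hz
      exact ⟨e, he, fun _ => hze⟩
    · exact ⟨0, D.zero_mem, fun h => absurd h hz⟩
  choose digit hdigitE hdigit using hdigit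
  let rem (k : ℕ) : Series M := Nat.rec y (fun i z => z - monomial M (N + i) (digit (N + i) z)) k
  have hrem (k : ℕ) : rem (k + 1) = rem k - monomial M (N + k) (digit (N + k) (rem k)) := rfl
  have hmem (k : ℕ) : rem k ∈ seriesFil L M (N + k) := by
    induction k with
    | zero => rwa [Nat.cast_zero, add_zero]
    | succ k ih =>
      rw [hrem, Nat.cast_succ, ← add_assoc]
      exact hdigit _ _ ih
  have hsum (k : ℕ) :
      y - ∑ i ∈ Finset.range k, monomial M (N + i) (digit (N + i) (rem i)) = rem k := by
    induction k with
    | zero =>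
      rw [Finset.sum_range_zero, sub_zero]
      rfl
    | succ k ih => rw [Finset.sum_range_succ, ← sub_sub, ih, hrem]
  exact ⟨fun i => digit (N + i) (rem i), fun i => hdigitE _ _, fun k => hsum k ▸ hmem k⟩

theorem exists_expansion {y : Series M} {N : ℤ} (hy : y ∈ seriesFil L M N) :
    ∃ d, IsExpansion M E y d ∧ ∀ j < N, d j = 0 := by
  obtain ⟨e, heE, he⟩ := D.exists_greedy_digits hy
  let d (j : ℤ) : Fin n → ℤ := if j < N then 0 else e (j - N).toNat
  have hdE (j) : d j ∈ E := by
    unfold d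
    split_ifs
    exacts [D.zero_mem, heE _]
  have hd0 : ∀ j < N, d j = 0 := fun j hj => if_pos hj
  have hde (i : ℕ) : d (N + i) = e i := by
    unfold d
    rw [if_neg (by omega), add_sub_cancel_left, Int.toNat_natCast]
  refine ⟨d, ⟨hdE, ⟨N, hd0⟩, ?_⟩, hd0⟩
  refine (D.full.hasSum_monomial_iff (fun j => D.intVec_mem (hdE j)) hd0).2 fun k => ?_
  rcases le_total N k with hk | hk
  · obtain ⟨i, rfl⟩ := Int.le.dest hk
    have hsum : ∑ j ∈ Finset.Ico N (N + i), monomial M j (d j) =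
        ∑ i ∈ Finset.range i, monomial M (N + i) (e i) := by
      simp [Int.Ico_eq_finset_map, hde]
    rw [hsum]
    exact he i
  · rw [Finset.Ico_eq_empty (by omega), Finset.sum_empty, sub_zero]
    exact seriesFil_antitone L M hk hy

theorem isExpansion_unique {y : Series M} {d d' : ℤ → Fin n → ℤ} (h : IsExpansion M E y d)
    (h' : IsExpansion M E y d') : d = d' := by
  obtain ⟨hdE, ⟨N, hN⟩, hsum⟩ := h
  obtain ⟨hdE', ⟨N', hN'⟩, hsum'⟩ := h'
  have h0 : ∀ j < min N N', d j = 0 := fun j hj => hN j (hj.trans_le (min_le_left _ _))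
  have h0' : ∀ j < min N N', d' j = 0 := fun j hj => hN' j (hj.trans_le (min_le_right _ _))
  rw [D.full.hasSum_monomial_iff (fun j => D.intVec_mem (hdE j)) h0] at hsum
  rw [D.full.hasSum_monomial_iff (fun j => D.intVec_mem (hdE' j)) h0'] at hsum'
  by_contra hne
  obtain ⟨j, hj, hleast⟩ := Int.exists_least_of_bdd (P := fun j => d j ≠ d' j)
    ⟨min N N', fun j hj => not_lt.1 fun hlt => hj ((h0 j hlt).trans (h0' j hlt).symm)⟩
    (Function.ne_iff.1 hne)
  have hle : min N N' ≤ j := not_lt.1 fun hlt => hj ((h0 j hlt).trans (h0' j hlt).symm)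
  refine hj (D.digit_unique (j := j) (hdE j) (hdE' j) ?_)
  have hprefix : ∑ i ∈ Finset.Ico (min N N') j, monomial M i (d i) =
      ∑ i ∈ Finset.Ico (min N N') j, monomial M i (d' i) :=
    Finset.sum_congr rfl fun i hi => by
      rw [not_not.1 fun hi' => (hleast i hi').not_gt (Finset.mem_Ico.1 hi).2]
  have hsub := sub_mem (hsum' (j + 1)) (hsum (j + 1))
  rwa [← Finset.insert_Ico_right_eq_Ico_add_one hle,
    Finset.sum_insert Finset.right_notMem_Ico, Finset.sum_insert Finset.right_notMem_Ico,
    hprefix, sub_sub_sub_cancel_left, add_sub_add_right_eq_sub] at hsub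

theorem existsUnique_isExpansion (y : Series M) : ∃! d, IsExpansion M E y d := by
  obtain ⟨N, hN⟩ := D.full.exists_mem_seriesFil y
  obtain ⟨d, hd, -⟩ := D.exists_expansion hN
  exact ⟨d, hd, fun d' hd' => D.isExpansion_unique hd' hd⟩

theorem isExpansion_digits (y : Series M) : IsExpansion M E y (digits M E y) := by
  have h := (D.existsUnique_isExpansion y).exists
  unfold digits
  rw [dif_pos h]
  exact h.choose_spec

theorem digits_eq {y : Series M} {d : ℤ → Fin n → ℤ} (h : IsExpansion M E y d) :
    digits M E y = d :=
  D.isExpansion_unique (D.isExpansion_digits y) h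

theorem intVec_digits_mem (y : Series M) (j : ℤ) : intVec n (digits M E y j) ∈ L :=
  D.intVec_mem ((D.isExpansion_digits y).1 j)

theorem digits_eq_zero {y : Series M} {N : ℤ} (hy : y ∈ seriesFil L M N) {j : ℤ} (hj : j < N) :
    digits M E y j = 0 := by
  obtain ⟨d, hd, h0⟩ := D.exists_expansion hy
  rw [D.digits_eq hd, h0 j hj]

theorem sub_sum_digits_mem {y : Series M} {N : ℤ} (hy : y ∈ seriesFil L M N) (k : ℤ) :
    y - ∑ j ∈ Finset.Ico N k, monomial M j (digits M E y j) ∈ seriesFil L M k :=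
  (D.full.hasSum_monomial_iff (D.intVec_digits_mem y) fun _ hj => D.digits_eq_zero hy hj).1
    (D.isExpansion_digits y).2.2 k

theorem digits_seriesMul (i : ℤ) (y : Series M) (j : ℤ) :
    digits M E (seriesMul M i y) j = digits M E y (j - i) := by
  obtain ⟨hE, ⟨N, hN⟩, hsum⟩ := D.isExpansion_digits y
  suffices h : IsExpansion M E (seriesMul M i y) fun j => digits M E y (j - i) from
    congrFun (D.digits_eq h) j
  refine ⟨fun j => hE (j - i), ⟨N + i, fun j hj => hN _ (by omega)⟩, ?_⟩
  have hmap := hsum.map (seriesMul M i) (continuous_seriesMul M i)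
  rw [← (Equiv.subRight i).hasSum_iff] at hmap
  simpa [Function.comp_def, seriesMul_monomial] using hmap

theorem fracPart_eq_sum {y : Series M} {N : ℤ} (hy : y ∈ seriesFil L M N) :
    fracPart M E y = ∑ j ∈ Finset.Ico N 0, act (M ^ j) (intVec n (digits M E y j)) := by
  refine finsum_mem_eq_sum_of_inter_support_eq _ (s := {j : ℤ | j < 0}) (Set.ext fun j => ?_)
  rw [Finset.coe_Ico, Set.mem_inter_iff, Set.mem_inter_iff, Set.mem_Ico]
  refine and_congr_left fun hj => ⟨fun h0 => ⟨?_, h0⟩, fun h => h.2⟩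
  by_contra! hlt
  rw [Function.mem_support, D.digits_eq_zero hy hlt, map_zero, map_zero] at hj
  exact hj rfl

theorem fracPart_eq_zero {y : Series M} (hy : y ∈ seriesFil L M 0) : fracPart M E y = 0 := by
  rw [D.fracPart_eq_sum hy, Finset.Ico_self, Finset.sum_empty]

theorem fracPart_mem_laurent (y : Series M) : fracPart M E y ∈ laurent M := by
  obtain ⟨N, hN⟩ := D.full.exists_mem_seriesFil y
  rw [D.fracPart_eq_sum hN]
  exact sum_mem fun j _ => act_intVec_mem_laurent M j _

theorem fracPart_mem_poly_inv (y : Series M) : fracPart M E y ∈ poly L M⁻¹ := by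
  obtain ⟨N, hN⟩ := D.full.exists_mem_seriesFil y
  rw [D.fracPart_eq_sum hN]
  exact sum_mem fun j hj =>
    act_zpow_mem_poly_inv (D.intVec_digits_mem y j) (Finset.mem_Ico.1 hj).2.le

theorem sub_fracPart_mem_seriesFil (y : Series M) :
    y - toSeries M (ofLaurent (D.fracPart_mem_laurent y)) ∈ seriesFil L M 0 := by
  obtain ⟨N, hN⟩ := D.full.exists_mem_seriesFil y
  convert D.sub_sum_digits_mem hN 0 using 2
  simp only [monomial_eq_toSeries]
  rw [← map_sum]
  congr 1
  apply laurentVal_injective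
  rw [laurentVal_ofLaurent, map_sum, D.fracPart_eq_sum hN]
  rfl

theorem sub_fracPart_mem {x : Fin n → ℚ} {y : Series M} (hx : x ∈ poly L M⁻¹)
    (hx' : x ∈ laurent M) (h : y - toSeries M (ofLaurent hx') ∈ seriesFil L M 0) :
    x - fracPart M E y ∈ poly L M⁻¹ ⊓ poly L M := by
  have hinv : x - fracPart M E y ∈ poly L M⁻¹ := sub_mem hx (D.fracPart_mem_poly_inv y)
  refine ⟨hinv, ?_⟩
  obtain ⟨j, hj⟩ := exists_mem_polyFil_of_mem_poly_inv hinv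
  have hsub := sub_mem (D.sub_fracPart_mem_seriesFil y) h
  rw [sub_sub_sub_cancel_left, ← map_sub] at hsub
  rw [← polyFil_zero]
  exact D.full.mem_polyFil_of_toSeries_mem (x := ofLaurent hx' - ofLaurent _) hj hsub

theorem fracPart_add (y y' : Series M) :
    fracPart M E y + fracPart M E y' - fracPart M E (y + y') ∈ poly L M⁻¹ ⊓ poly L M := by
  refine D.sub_fracPart_mem
    (add_mem (D.fracPart_mem_poly_inv y) (D.fracPart_mem_poly_inv y'))
    (add_mem (D.fracPart_mem_laurent y) (D.fracPart_mem_laurent y')) ?_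
  have hadd := add_mem (D.sub_fracPart_mem_seriesFil y) (D.sub_fracPart_mem_seriesFil y')
  rwa [← add_sub_add_comm, ← map_add] at hadd

theorem fracPart_monomial_of_nonpos {z : Fin n → ℤ} (hz : intVec n z ∈ L) {j : ℤ} (hj : j ≤ 0) :
    act (M ^ j) (intVec n z) - fracPart M E (monomial M j z) ∈ poly L M⁻¹ ⊓ poly L M := by
  refine D.sub_fracPart_mem (act_zpow_mem_poly_inv hz hj) (act_intVec_mem_laurent M j z) ?_
  rw [← monomial_eq_toSeries, sub_self]
  exact AddSubgroup.zero_mem _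

theorem fracPart_monomial_of_nonneg {z : Fin n → ℤ} (hz : intVec n z ∈ L) {j : ℤ} (hj : 0 ≤ j) :
    fracPart M E (monomial M j z) = 0 :=
  D.fracPart_eq_zero (seriesFil_antitone L M hj (monomial_mem_seriesFil hz j))

end IsDigitSystem

end Expansion

section RatExp

/-- The character `q ↦ exp(2πiq)` of `ℚ`, through which the rational pairing is read modulo `ℤ`. -/
def ratExp : AddChar ℚ Circle where
  toFun q := Circle.exp (2 * Real.pi * (q : ℝ))
  map_zero_eq_one' := by rw [Rat.cast_zero, mul_zero, Circle.exp_zero]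
  map_add_eq_mul' p q := by rw [← Circle.exp_add, Rat.cast_add, mul_add]

theorem ratExp_eq_one_iff {q : ℚ} : ratExp q = 1 ↔ ∃ m : ℤ, q = m := by
  change Circle.exp (2 * Real.pi * (q : ℝ)) = 1 ↔ _
  rw [Circle.exp_eq_one]
  refine exists_congr fun m => ?_
  rw [mul_comm, mul_left_inj' (by positivity)]
  exact_mod_cast Iff.rfl

theorem ratExp_eq_ratExp_iff {p q : ℚ} : ratExp p = ratExp q ↔ ∃ m : ℤ, p - q = m := by
  rw [← ratExp_eq_one_iff, AddChar.map_sub_eq_div, div_eq_one]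

theorem ratExp_sum {ι : Type*} (s : Finset ι) (f : ι → ℚ) :
    ratExp (∑ i ∈ s, f i) = ∏ i ∈ s, ratExp (f i) :=
  map_prod ratExp.toMonoidHom (fun i => Multiplicative.ofAdd (f i)) s

end RatExp

section Transpose

theorem dotProduct_act_transpose (M : GL (Fin n) ℚ) (i : ℤ) (u v : Fin n → ℚ) :
    act (M ^ i) u ⬝ᵥ v = u ⬝ᵥ act (transposeGL M ^ i) v := by
  have h : ((transposeGL M ^ i : GL (Fin n) ℚ) : Matrix (Fin n) (Fin n) ℚ) =
      ((M ^ i : GL (Fin n) ℚ) : Matrix (Fin n) (Fin n) ℚ)ᵀ := by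
    rw [Matrix.coe_units_zpow, Matrix.coe_units_zpow, Matrix.transpose_zpow]
    rfl
  simp only [act, LinearMap.coe_restrictScalars, Matrix.mulVecLin_apply, h]
  rw [Matrix.mulVec_transpose, dotProduct_comm, Matrix.dotProduct_mulVec, dotProduct_comm]

theorem transposeGL_inv (A : GL (Fin n) ℚ) : transposeGL A⁻¹ = (transposeGL A)⁻¹ :=
  rfl

theorem intVec_mem_std (z : Fin n → ℤ) : intVec n z ∈ stdLattice n := ⟨z, rfl⟩

theorem mem_stdLattice_of_dotProduct {v : Fin n → ℚ}
    (h : ∀ z : Fin n → ℤ, ∃ m : ℤ, intVec n z ⬝ᵥ v = m) : v ∈ stdLattice n := by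
  choose m hm using fun i => h (Pi.single i 1)
  refine ⟨m, funext fun i => (hm i).symm.trans ?_⟩
  have hsingle : intVec n (Pi.single i 1) = Pi.single i 1 := by
    ext j
    exact Pi.apply_single (fun _ (a : ℤ) => (a : ℚ)) (fun _ => Int.cast_zero) i 1 j |>.trans
      (by rw [Int.cast_one])
  rw [hsingle, single_one_dotProduct]

theorem dualLattice_anti {Λ Λ' : Submodule ℤ (Fin n → ℚ)} (h : Λ ≤ Λ') :
    dualLattice Λ' ≤ dualLattice Λ :=
  fun _ hx => ⟨hx.1, fun z hz => hx.2 z (h hz)⟩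

end Transpose

section Generation

variable {M : GL (Fin n) ℚ}

theorem eq_top_of_monomial_mem {W : AddSubgroup (Series M)} {k : ℤ}
    (hW : ∀ j z, monomial M j z ∈ W) (hk : seriesFil (stdLattice n) M k ≤ W) : W = ⊤ := by
  have hlaurent : laurent M ≤
      ((W.comap (toSeries M)).map (laurentVal M)).toIntSubmodule := by
    refine iSup_le fun j => ?_
    rintro _ ⟨_, ⟨z, rfl⟩, rfl⟩
    exact ⟨ofLaurent (act_intVec_mem_laurent M j z), hW j z, rfl⟩
  refine eq_top_iff.2 fun y _ => ?_
  obtain ⟨j, hj⟩ := exists_mem_seriesFil_std y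
  obtain ⟨x, -, hx⟩ := isFullSublattice_std.exists_sub_toSeries_mem_seriesFil hj k
  obtain ⟨x', hx', hxx'⟩ := hlaurent (laurentVal_mem x)
  rw [laurentVal_injective M hxx'] at hx'
  simpa only [sub_add_cancel] using add_mem (hk hx) hx'

theorem eq_of_eq_on_monomial {f g : Series M → Circle} (hf : ∀ x y, f (x + y) = f x * f y)
    (hg : ∀ x y, g (x + y) = g x * g y) {k : ℤ}
    (hk : ∀ y ∈ seriesFil (stdLattice n) M k, f y = g y)
    (h : ∀ j z, f (monomial M j z) = g (monomial M j z)) : f = g := by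
  let W := (AddMonoidHom.mk' (fun x => Additive.ofMul (f x)) hf).eqLocus
    (AddMonoidHom.mk' (fun x => Additive.ofMul (g x)) hg)
  have hW : W = ⊤ := eq_top_of_monomial_mem (k := k) h hk
  exact funext fun y => (hW ▸ AddSubgroup.mem_top y : y ∈ W)

end Generation

section AdicPairing

/-- The hypotheses under which `adicChar` is a pairing of `ℤⁿ((B*))` with `ℤⁿ((B))`: digit sets `E`
over `ℤⁿ` and `F` over `Γ` such that `ℤⁿ[B⁻¹] ∩ ℤⁿ[B]` and `Γ[B*⁻¹] ∩ Γ[B*]`, the ambiguities of the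
fractional parts, pair integrally. -/
structure IsPairingData (B : GL (Fin n) ℚ) (Γ : Submodule ℤ (Fin n → ℚ))
    (E F : Set (Fin n → ℤ)) : Prop where
  left : IsDigitSystem (stdLattice n) B E
  right : IsDigitSystem Γ (transposeGL B) F
  integral : ∀ u ∈ poly (stdLattice n) B⁻¹ ⊓ poly (stdLattice n) B,
    ∀ v ∈ poly Γ (transposeGL B)⁻¹ ⊓ poly Γ (transposeGL B), ∃ m : ℤ, u ⬝ᵥ v = m

namespace IsPairingData

variable {B : GL (Fin n) ℚ} {Γ : Submodule ℤ (Fin n → ℚ)} {E F : Set (Fin n → ℤ)}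
  (P : IsPairingData B Γ E F)

include P

theorem ratExp_dotProduct_congr_left {u u' v : Fin n → ℚ}
    (hu : u - u' ∈ poly (stdLattice n) B⁻¹ ⊓ poly (stdLattice n) B) (hv : v ∈ Γ) :
    ratExp (u ⬝ᵥ v) = ratExp (u' ⬝ᵥ v) := by
  rw [ratExp_eq_ratExp_iff, ← sub_dotProduct]
  exact P.integral _ hu _ ⟨le_poly _ _ hv, le_poly _ _ hv⟩

theorem ratExp_dotProduct_congr_right {u v v' : Fin n → ℚ} (hu : u ∈ stdLattice n)
    (hv : v - v' ∈ poly Γ (transposeGL B)⁻¹ ⊓ poly Γ (transposeGL B)) :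
    ratExp (u ⬝ᵥ v) = ratExp (u ⬝ᵥ v') := by
  rw [ratExp_eq_ratExp_iff, ← dotProduct_sub]
  exact P.integral _ ⟨le_poly _ _ hu, le_poly _ _ hu⟩ _ hv

theorem ratExp_fracPart_add (y y' : Series B) {v : Fin n → ℚ} (hv : v ∈ Γ) :
    ratExp (fracPart B E (y + y') ⬝ᵥ v) =
      ratExp (fracPart B E y ⬝ᵥ v) * ratExp (fracPart B E y' ⬝ᵥ v) := by
  rw [← AddChar.map_add_eq_mul, ← add_dotProduct]
  exact (P.ratExp_dotProduct_congr_left (P.left.fracPart_add y y') hv).symm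

theorem fracPart_seriesMul_eq_zero {y : Series B} {j k : ℤ}
    (hy : y ∈ seriesFil (stdLattice n) B k) (hj : -k ≤ j) :
    fracPart B E (seriesMul B j y) = 0 :=
  P.left.fracPart_eq_zero (seriesFil_antitone _ B (by omega) (seriesMul_mem_seriesFil (j := j) hy))

theorem support_pairing_subset {s : Series (transposeGL B)} {y : Series B} {k l : ℤ}
    (hs : s ∈ seriesFil Γ (transposeGL B) l) (hy : y ∈ seriesFil (stdLattice n) B k) :
    {j : ℤ | fracPart B E (seriesMul B j y) ≠ 0 ∧ digits (transposeGL B) F s j ≠ 0} ⊆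
      Finset.Ico l (-k) := by
  rintro j ⟨hjy, hjs⟩
  rw [Finset.coe_Ico, Set.mem_Ico]
  constructor
  · contrapose! hjs
    exact P.right.digits_eq_zero hs hjs
  · contrapose! hjy
    exact P.fracPart_seriesMul_eq_zero hy hjy

theorem finite_support_pairing (s : Series (transposeGL B)) (y : Series B) :
    {j : ℤ | fracPart B E (seriesMul B j y) ≠ 0 ∧
      digits (transposeGL B) F s j ≠ 0}.Finite := by
  obtain ⟨l, hs⟩ := P.right.full.exists_mem_seriesFil s
  obtain ⟨k, hy⟩ := exists_mem_seriesFil_std y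
  exact (Finset.finite_toSet _).subset (P.support_pairing_subset hs hy)

theorem pairing_eq_sum {s : Series (transposeGL B)} {y : Series B} {k l : ℤ}
    (hs : s ∈ seriesFil Γ (transposeGL B) l) (hy : y ∈ seriesFil (stdLattice n) B k) :
    pairing B E F s y = ∑ j ∈ Finset.Ico l (-k),
      fracPart B E (seriesMul B j y) ⬝ᵥ intVec n (digits (transposeGL B) F s j) := by
  refine finsum_eq_sum_of_support_subset _ fun j hj => P.support_pairing_subset hs hy ⟨?_, ?_⟩
  all_goals
    refine fun h => hj ?_
    simp only [h, map_zero, zero_dotProduct, dotProduct_zero]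

theorem adicChar_eq_prod {s : Series (transposeGL B)} {y : Series B} {k l : ℤ}
    (hs : s ∈ seriesFil Γ (transposeGL B) l) (hy : y ∈ seriesFil (stdLattice n) B k) :
    adicChar B E F s y = ∏ j ∈ Finset.Ico l (-k),
      ratExp (fracPart B E (seriesMul B j y) ⬝ᵥ intVec n (digits (transposeGL B) F s j)) := by
  rw [← ratExp_sum, ← P.pairing_eq_sum hs hy]
  rfl

theorem adicChar_eq_one {s : Series (transposeGL B)} {y : Series B} {k l : ℤ}
    (hs : s ∈ seriesFil Γ (transposeGL B) l) (hy : y ∈ seriesFil (stdLattice n) B k)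
    (hkl : 0 ≤ k + l) : adicChar B E F s y = 1 := by
  rw [P.adicChar_eq_prod hs hy, Finset.Ico_eq_empty (by omega), Finset.prod_empty]

theorem adicChar_add_right (s : Series (transposeGL B)) (y y' : Series B) :
    adicChar B E F s (y + y') = adicChar B E F s y * adicChar B E F s y' := by
  obtain ⟨l, hs⟩ := P.right.full.exists_mem_seriesFil s
  obtain ⟨k₁, hy₁⟩ := exists_mem_seriesFil_std y
  obtain ⟨k₂, hy₂⟩ := exists_mem_seriesFil_std y'
  have hy := seriesFil_antitone _ B (min_le_left k₁ k₂) hy₁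
  have hy' := seriesFil_antitone _ B (min_le_right k₁ k₂) hy₂
  rw [P.adicChar_eq_prod hs hy, P.adicChar_eq_prod hs hy', P.adicChar_eq_prod hs (add_mem hy hy'),
    ← Finset.prod_mul_distrib]
  refine Finset.prod_congr rfl fun j _ => ?_
  rw [map_add]
  exact P.ratExp_fracPart_add _ _ (P.right.intVec_digits_mem s j)

theorem ratExp_fracPart_monomial {k : ℤ} (hk : k ≤ 0) (z : Fin n → ℤ) {v : Fin n → ℚ}
    (hv : v ∈ Γ) :
    ratExp (fracPart B E (monomial B k z) ⬝ᵥ v) =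
      ratExp (intVec n z ⬝ᵥ act (transposeGL B ^ k) v) := by
  rw [← dotProduct_act_transpose]
  exact (P.ratExp_dotProduct_congr_left (P.left.fracPart_monomial_of_nonpos (intVec_mem_std z) hk)
    hv).symm

theorem adicChar_monomial_right (s : Series (transposeGL B)) (k : ℤ) (z : Fin n → ℤ) :
    adicChar B E F s (monomial B k z) =
      ratExp (intVec n z ⬝ᵥ fracPart (transposeGL B) F (seriesMul (transposeGL B) k s)) := by
  obtain ⟨l, hs⟩ := P.right.full.exists_mem_seriesFil s
  rw [P.adicChar_eq_prod hs (monomial_mem_seriesFil (intVec_mem_std z) k),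
    P.right.fracPart_eq_sum (seriesMul_mem_seriesFil hs), dotProduct_sum, ratExp_sum,
    ← neg_add_cancel k, ← Finset.map_add_right_Ico, Finset.prod_map]
  refine Finset.prod_congr rfl fun j hj => ?_
  rw [Finset.mem_Ico] at hj
  rw [addRightEmbedding_apply, seriesMul_monomial, P.right.digits_seriesMul, add_sub_cancel_right]
  exact P.ratExp_fracPart_monomial (by omega) z (P.right.intVec_digits_mem s j)

theorem adicChar_add_left (s s' : Series (transposeGL B)) (y : Series B) :
    adicChar B E F (s + s') y = adicChar B E F s y * adicChar B E F s' y := by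
  obtain ⟨l₁, hs₁⟩ := P.right.full.exists_mem_seriesFil s
  obtain ⟨l₂, hs₂⟩ := P.right.full.exists_mem_seriesFil s'
  have hs := seriesFil_antitone _ _ (min_le_left l₁ l₂) hs₁
  have hs' := seriesFil_antitone _ _ (min_le_right l₁ l₂) hs₂
  refine congrFun (eq_of_eq_on_monomial (g := fun y => adicChar B E F s y * adicChar B E F s' y)
    (k := -min l₁ l₂) (P.adicChar_add_right _) (fun x y => ?_) (fun y hy => ?_) fun j z => ?_) y
  · rw [P.adicChar_add_right, P.adicChar_add_right, mul_mul_mul_comm]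
  · rw [P.adicChar_eq_one (add_mem hs hs') hy (by omega), P.adicChar_eq_one hs hy (by omega),
      P.adicChar_eq_one hs' hy (by omega), one_mul]
  · rw [P.adicChar_monomial_right, P.adicChar_monomial_right, P.adicChar_monomial_right,
      ← AddChar.map_add_eq_mul, ← dotProduct_add, map_add]
    exact (P.ratExp_dotProduct_congr_right (intVec_mem_std z) (P.right.fracPart_add _ _)).symm

theorem adicChar_monomial_left (j : ℤ) {γ : Fin n → ℤ} (hγ : intVec n γ ∈ Γ) (y : Series B) :
    adicChar B E F (monomial (transposeGL B) j γ) y =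
      ratExp (fracPart B E (seriesMul B j y) ⬝ᵥ intVec n γ) := by
  refine congrFun (eq_of_eq_on_monomial
    (g := fun y => ratExp (fracPart B E (seriesMul B j y) ⬝ᵥ intVec n γ)) (k := -j)
    (P.adicChar_add_right _) (fun x y => ?_) (fun y hy => ?_) fun k z => ?_) y
  · rw [map_add, P.ratExp_fracPart_add _ _ hγ]
  · rw [P.adicChar_eq_one (monomial_mem_seriesFil hγ j) hy (by omega),
      P.fracPart_seriesMul_eq_zero hy (by omega), zero_dotProduct, AddChar.map_zero_eq_one]
  · rw [P.adicChar_monomial_right, seriesMul_monomial, seriesMul_monomial, add_comm k j]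
    rcases le_total (j + k) 0 with hjk | hjk
    · rw [P.ratExp_fracPart_monomial hjk z hγ]
      exact (P.ratExp_dotProduct_congr_right (intVec_mem_std z)
        (P.right.fracPart_monomial_of_nonpos hγ hjk)).symm
    · rw [P.right.fracPart_monomial_of_nonneg hγ hjk,
        P.left.fracPart_monomial_of_nonneg (intVec_mem_std z) hjk, zero_dotProduct,
        dotProduct_zero]

theorem mem_seriesFil_of_adicChar_eq_one {k : ℤ} {s : Series (transposeGL B)}
    (h : ∀ y ∈ seriesFil (stdLattice n) B k, adicChar B E F s y = 1) :
    s ∈ seriesFil (stdLattice n) (transposeGL B) (-k) := by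
  have hfrac : fracPart (transposeGL B) F (seriesMul (transposeGL B) k s) ∈ stdLattice n := by
    refine mem_stdLattice_of_dotProduct fun z => ?_
    rw [← ratExp_eq_one_iff, ← P.adicChar_monomial_right]
    exact h _ (monomial_mem_seriesFil (intVec_mem_std z) k)
  have hseries : toSeries (transposeGL B) (ofLaurent (P.right.fracPart_mem_laurent
      (seriesMul (transposeGL B) k s))) ∈ seriesFil (stdLattice n) (transposeGL B) 0 := by
    refine toSeries_mem_seriesFil ?_
    rw [polyFil_zero, laurentVal_ofLaurent]
    exact le_poly _ _ hfrac
  have hmem := add_mem (seriesFil_mono P.right.full.le_std _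
    (P.right.sub_fracPart_mem_seriesFil (seriesMul (transposeGL B) k s))) hseries
  rwa [sub_add_cancel, ← neg_add_cancel k, seriesMul_mem_seriesFil_iff] at hmem

theorem smul_fracPart_mem_std {y : Series B} (h : ∀ s, adicChar B E F s y = 1) {N : ℕ}
    (hN : ∀ x ∈ stdLattice n, (N : ℤ) • x ∈ Γ) (j : ℤ) :
    (N : ℤ) • fracPart B E (seriesMul B j y) ∈ stdLattice n := by
  refine mem_stdLattice_of_dotProduct fun z => ?_
  have hz : intVec n ((N : ℤ) • z) ∈ Γ := by
    rw [map_smul]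
    exact hN _ (intVec_mem_std z)
  have hone := h (monomial (transposeGL B) j ((N : ℤ) • z))
  rwa [P.adicChar_monomial_left j hz, map_smul, dotProduct_smul, ← smul_dotProduct,
    dotProduct_comm, ratExp_eq_one_iff] at hone

theorem eq_zero_of_adicChar_eq_one {y : Series B} (h : ∀ s, adicChar B E F s y = 1) : y = 0 := by
  obtain ⟨N, hN, hNΓ⟩ := P.right.full.exists_smul
  obtain ⟨m, hm⟩ := exists_fil_of_smul_mem_std B hN
  have hmul (j : ℤ) : seriesMul B j y ∈ seriesFil (stdLattice n) B (min m 0) := by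
    have hfrac := toSeries_mem_seriesFil (L := stdLattice n)
      (x := ofLaurent (P.left.fracPart_mem_laurent (seriesMul B j y)))
      (hm _ (P.left.fracPart_mem_laurent _) (P.smul_fracPart_mem_std h hNΓ j))
    have hadd := add_mem
      (seriesFil_antitone _ B (min_le_right m 0)
        (P.left.sub_fracPart_mem_seriesFil (seriesMul B j y)))
      (seriesFil_antitone _ B (min_le_left m 0) hfrac)
    rwa [sub_add_cancel] at hadd
  refine eq_zero_of_forall_mem_seriesFil_std fun k => ?_
  rw [← seriesMul_mem_seriesFil_iff (j := min m 0 - k), add_sub_cancel]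
  exact hmul _

theorem isFilteredPairing : IsFilteredPairing (adicChar B E F)
    (seriesFil (stdLattice n) (transposeGL B)) (seriesFil (stdLattice n) B) where
  map_add_left := P.adicChar_add_left
  map_add_right := P.adicChar_add_right
  antitone := seriesFil_antitone _ _
  isCompact_left := isCompact_seriesFil_std
  isCompact_right := isCompact_seriesFil_std
  isOpen_left := isOpen_seriesFil_std
  isOpen_right := isOpen_seriesFil_std
  exists_subset_left _ hW := by
    obtain ⟨k, -, hk⟩ := (hasBasis_nhds_zero _).mem_iff.1 hW
    exact ⟨k, hk⟩
  exists_mem_left := exists_mem_seriesFil_std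
  exists_mem_right := exists_mem_seriesFil_std
  eq_one := by
    obtain ⟨m, hm⟩ := P.right.full.exists_seriesFil_std_le (transposeGL B)
    exact ⟨m, fun k l hkl s hs y hy => P.adicChar_eq_one (hm l hs) hy (by omega)⟩
  mem_of_eq_one _ _ := P.mem_seriesFil_of_adicChar_eq_one
  eq_zero _ := P.eq_zero_of_adicChar_eq_one

theorem isDuality : IsDuality (adicChar B E F) :=
  P.isFilteredPairing.isDuality

end IsPairingData

theorem isPairingData_of_le_dualLattice {A : GL (Fin n) ℚ} {Γ : Submodule ℤ (Fin n → ℚ)}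
    (hΓ : Submodule.IsLattice ℚ Γ)
    (hdual : poly Γ (transposeGL A) ⊓ poly Γ (transposeGL A⁻¹) ≤
      dualLattice (poly (stdLattice n) A ⊓ poly (stdLattice n) A⁻¹))
    {E F : Set (Fin n → ℤ)} (hE : IsResidueSystem (stdLattice n) A⁻¹ E)
    (hF : IsResidueSystem Γ (transposeGL A⁻¹) F) : IsPairingData A⁻¹ Γ E F where
  left := ⟨isFullSublattice_std, hE⟩
  right :=
    { full :=
        { le_std := fun x hx => (hdual ⟨le_poly Γ _ hx, le_poly Γ _ hx⟩).1
          exists_smul := exists_natCast_smul_mem_of_fg stdLattice_fg hΓ.span_eq_top }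
      residue := hF }
  integral := by
    rw [transposeGL_inv, inv_inv, inv_inv]
    intro u hu v hv
    rw [dotProduct_comm]
    exact (hdual hv).2 u hu

end AdicPairing

end RationalTile

end

open RationalTile in
theorem mainTheorem7_general {n : ℕ} (A : GL (Fin n) ℚ) (Γ : Submodule ℤ (Fin n → ℚ))
    (hΓ : Submodule.IsLattice ℚ Γ)
    (hdual : poly Γ (transposeGL A) ⊓ poly Γ (transposeGL A⁻¹) ≤
      dualLattice (poly (stdLattice n) A ⊓ poly (stdLattice n) A⁻¹))
    (E F : Set (Fin n → ℤ)) (hE : IsResidueSystem (stdLattice n) A⁻¹ E)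
    (hF : IsResidueSystem Γ (transposeGL A⁻¹) F) :
    (∀ y : Series A⁻¹, ∃! d, IsExpansion A⁻¹ E y d) ∧
    (∀ s : Series (transposeGL A⁻¹), ∃! d, IsExpansion (transposeGL A⁻¹) F s d) ∧
    (∀ (s : Series (transposeGL A⁻¹)) (y : Series A⁻¹),
      {j : ℤ | fracPart A⁻¹ E (seriesMul A⁻¹ j y) ≠ 0 ∧
        digits (transposeGL A⁻¹) F s j ≠ 0}.Finite) ∧
    (∀ χ : RepSpace A → Circle, IsCharacter χ ↔
      ∃ (r : EuclideanSpace ℝ (Fin n)) (s : Series (transposeGL A⁻¹)),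
        ∀ x y, χ (x, y) = realChar r x * adicChar A⁻¹ E F s y) ∧
    (∃ Φ : Multiplicative (EuclideanSpace ℝ (Fin n) × Series (transposeGL A⁻¹)) ≃ₜ*
        PontryaginDual (Multiplicative (RepSpace A)),
      ∀ r s x y, Φ (Multiplicative.ofAdd (r, s)) (Multiplicative.ofAdd (x, y)) =
        realChar r x * adicChar A⁻¹ E F s y) ∧
    (∃ Ψ : Multiplicative (Series (transposeGL A⁻¹)) ≃ₜ*
        PontryaginDual (Multiplicative (Series A⁻¹)),
      ∀ s y, Ψ (Multiplicative.ofAdd s) (Multiplicative.ofAdd y) = adicChar A⁻¹ E F s y) := by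
  have P := isPairingData_of_le_dualLattice hΓ hdual hE hF
  have D := (isDuality_realChar (n := n)).prod P.isDuality
  refine ⟨P.left.existsUnique_isExpansion, P.right.existsUnique_isExpansion,
    P.finite_support_pairing, fun χ => ?_, ⟨D.equivDual, fun _ _ _ _ => rfl⟩,
    ⟨P.isDuality.equivDual, fun _ _ => rfl⟩⟩
  simp only [D.isCharacter_iff, Prod.exists, funext_iff, Prod.forall, eq_comm]

theorem mainTheorem7 {n : ℕ} (A : GL (Fin n) ℚ)
    (hA : RationalTile.IsExpanding (A : Matrix (Fin n) (Fin n) ℚ))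
    (L Γ : Submodule ℤ (Fin n → ℚ)) (hL : Submodule.IsLattice ℚ L) (hΓ : Submodule.IsLattice ℚ Γ)
    (hAL : RationalTile.poly (RationalTile.stdLattice n) A ⊓
      RationalTile.poly (RationalTile.stdLattice n) A⁻¹ ≤ L)
    (hΓL : RationalTile.poly Γ (RationalTile.transposeGL A) ⊓
      RationalTile.poly Γ (RationalTile.transposeGL A⁻¹) ≤ RationalTile.dualLattice L)
    (E F : Set (Fin n → ℤ))
    (hE : RationalTile.IsResidueSystem (RationalTile.stdLattice n) A⁻¹ E)
    (hF : RationalTile.IsResidueSystem Γ (RationalTile.transposeGL A⁻¹) F) :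
    -- the expansions exist and are unique, and the sum `S_s(y)` has finitely many nonzero terms
    (∀ y : RationalTile.Series A⁻¹, ∃! d, RationalTile.IsExpansion A⁻¹ E y d) ∧
    (∀ s : RationalTile.Series (RationalTile.transposeGL A⁻¹),
      ∃! d, RationalTile.IsExpansion (RationalTile.transposeGL A⁻¹) F s d) ∧
    (∀ (s : RationalTile.Series (RationalTile.transposeGL A⁻¹)) (y : RationalTile.Series A⁻¹),
      {j : ℤ | RationalTile.fracPart A⁻¹ E (RationalTile.seriesMul A⁻¹ j y) ≠ 0 ∧
        RationalTile.digits (RationalTile.transposeGL A⁻¹) F s j ≠ 0}.Finite) ∧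
    -- the characters of the representation space are exactly the `χ_{r,s}`
    (∀ χ : RationalTile.RepSpace A → Circle, RationalTile.IsCharacter χ ↔
      ∃ (r : EuclideanSpace ℝ (Fin n)) (s : RationalTile.Series (RationalTile.transposeGL A⁻¹)),
        ∀ x y, χ (x, y) = RationalTile.realChar r x * RationalTile.adicChar A⁻¹ E F s y) ∧
    -- `(r, s) ↦ χ_{r,s}` is an isomorphism of topological groups onto the dual
    (∃ Φ : Multiplicative (EuclideanSpace ℝ (Fin n) ×
          RationalTile.Series (RationalTile.transposeGL A⁻¹)) ≃ₜ*
        PontryaginDual (Multiplicative (RationalTile.RepSpace A)),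
      ∀ r s x y, Φ (Multiplicative.ofAdd (r, s)) (Multiplicative.ofAdd (x, y)) =
        RationalTile.realChar r x * RationalTile.adicChar A⁻¹ E F s y) ∧
    -- `s ↦ χ_s` is an isomorphism of topological groups onto the dual
    (∃ Ψ : Multiplicative (RationalTile.Series (RationalTile.transposeGL A⁻¹)) ≃ₜ*
        PontryaginDual (Multiplicative (RationalTile.Series A⁻¹)),
      ∀ s y, Ψ (Multiplicative.ofAdd s) (Multiplicative.ofAdd y) =
        RationalTile.adicChar A⁻¹ E F s y) :=
  mainTheorem7_general A Γ hΓ (hΓL.trans (RationalTile.dualLattice_anti hAL)) E F hE hF
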